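/- Let $\Sigma$ be a (Hausdorff) complex surface and let $V=\mathrm{Fr}(T\Sigma)\times_\rho\mathbb{C}^4$ be the rank $4$ holomorphic vector bundle associated with the tangent bundle $T\Sigma$ through a holomorphic representation $\rho:GL(2,\mathbb{C})\to GL(4,\mathbb{C})$. Let $(V,\langle\cdot,\cdot\rangle,\Lambda,\mathcal{D})$ be a complex conformal Cartan connection on $\Sigma$: $\langle\cdot,\cdot\rangle$ is a holomorphic nondegenerate symmetric complex bilinear form on the fibres of $V$, $\Lambda\subset V$ is a holomorphic null line subbundle, and $\mathcal{D}$ is a holomorphic linear connection on $V$ which preserves $\langle\cdot,\cdot\rangle$ and for which $\epsilon:=\mathcal{D}|_\Lambda \bmod \Lambda$ is an isomorphism $T\Sigma\otimes\Lambda\to\Lambda^\perp/\Lambda$. Let $U^+,U^-\subset\Lambda^\perp$ be the two null subbundles: holomorphic subbundles of rank $2$ whose fibres together form the solution set of $\langle a,a\rangle=0$ in $\Lambda^\perp$, with $U^+\cap U^-=\Lambda$. Let $t^\pm\subset T\Sigma$ be the line subbundles with $\epsilon(t^\pm\otimes\Lambda)=U^\pm/\Lambda$, let $C^\pm$ be the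 families of (connected, immersed, holomorphic) integral curves of $t^\pm$, and let $F^\pm=\mathbb{P}(U^\pm)$. A horizontal lift of a curve $c\in C^\pm$ to $U^\pm$ is a section $u$ of $U^\pm$ along $c$ with $\mathcal{D}_{c'}u=0$; its projectivization, for nowhere zero $u$, is a horizontal lift to $F^\pm$. For $W\subseteq\Sigma$ open, let $T^\pm(W)$ be the leaf space of the foliation of $F^\pm|_W$ by the horizontally lifted curves over curves in $W$ (two points are in the same leaf if a chain of such lifts joins them), so that $T^\pm=T^\pm(\Sigma)$. It carries the quotient topology, and a function on an open set of leaves is called holomorphic if its pullback to $F^\pm$ is. A map between such spaces is called holomorphic if it is continuous and pulls holomorphic functions back to holomorphic functions. Let $X$ be a holomorphic vector field on $\Sigma$ and let $\phi_t$, $t\in\mathbb{R}$, be a local $1$-parameter group of transformations generated by $X$, defined on an open set $\mathcal{O}\subseteq\mathbb{R}\times\Sigma$ whose slices $\{t:(t,\sigma)\in\mathcal{O}\}$ are intervals containing $0$. Let $\tilde\phi_t(\sigma,v)=(\phi_t(\sigma),(\phi_t)_*v)$ be its lift to $V$, where $(\phi_t)_*$ is induced through $\rho$ by the differential of $\phi_t$.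 Suppose that $X$ is a symmetry of the Cartan connection: every point of $\Sigma$ has a neighbourhood on which, for all sufficiently small $|t|$, the lifted flow maps $\Lambda$ to $\Lambda$, preserves $\langle\cdot,\cdot\rangle$, and satisfies $(\phi_t)_*\mathcal{D}=\mathcal{D}$. Then for each sign $\pm$ and every $t\in\mathbb{R}$: 1. For each $\sigma$ with $(t,\sigma)\in\mathcal{O}$, the lift $(\phi_t)_*:V_\sigma\to V_{\phi_t(\sigma)}$ is a linear isomorphism and maps $U^\pm_\sigma$ onto $U^\pm_{\phi_t(\sigma)}$. 2. $\tilde\phi_t(\sigma,\lambda v)=(\phi_t(\sigma),\lambda(\phi_t)_*v)$ for all $\lambda\in\mathbb{C}$, $v\in V_\sigma$. 3. If $c\in C^\pm$ lies in the domain of $\phi_t$ and $u$ is a horizontal lift of $c$ to $U^\pm$, then $\phi_t\circ c\in C^\pm$ and $\tilde\phi_t\circ u$ is a horizontal lift of $\phi_t\circ c$ to $U^\pm$. 4. Let $W,W'\subseteq\Sigma$ be open with $\{t\}\times W\subseteq\mathcal{O}$ and $\phi_t(W)\subseteq W'$. Then $\tilde\phi_t$ induces a holomorphic map $\tilde\phi_t^{\pm}:F^\pm|_W\to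 F^\pm|_{W'}$, $[\sigma,u]\mapsto[\phi_t(\sigma),(\phi_t)_*u]$, which descends to a holomorphic map $\tilde\phi_t'^{\pm}:T^\pm(W)\to T^\pm(W')$ of leaf spaces. If $\phi_t(W)=W'$, then both maps are bijective with holomorphic inverses. In particular, if $\phi_t$ is a globally defined transformation of $\Sigma$, then it induces a biholomorphic transformation of $T^\pm$. -/

import Mathlib

open Bundle Set Filter Topology
open scoped Manifold ContDiff TensorProduct

noncomputable section

namespace CartanSymmetry

/-- The model space `ℂ²` of a complex surface. -/
abbrev C2 := EuclideanSpace ℂ (Fin 2)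

/-- The model fibre `ℂ⁴` of a rank four bundle. -/
abbrev C4 := EuclideanSpace ℂ (Fin 4)

/-! ### The vector bundle associated with the tangent bundle -/

/-- A holomorphic representation of `GL(2, ℂ)` on `ℂ⁴`. -/
structure HolRep where
  toHom : (C2 →L[ℂ] C2)ˣ →* (C4 →L[ℂ] C4)ˣ
  holo : ContMDiff 𝓘(ℂ, C2 →L[ℂ] C2) 𝓘(ℂ, C4 →L[ℂ] C4) ω toHom

open Classical in
/-- The linear map `ρ(L)` (with the value `0` when `L` is not invertible). -/
def HolRep.map (ρ : HolRep) (L : C2 →L[ℂ] C2) : C4 →L[ℂ] C4 :=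
  if h : IsUnit L then (ρ.toHom h.unit : C4 →L[ℂ] C4) else 0

theorem HolRep.map_unit (ρ : HolRep) (g : (C2 →L[ℂ] C2)ˣ) :
    ρ.map (g : C2 →L[ℂ] C2) = (ρ.toHom g : C4 →L[ℂ] C4) := by
  simp [HolRep.map]

theorem HolRep.map_one (ρ : HolRep) : ρ.map 1 = 1 := by
  simpa using ρ.map_unit 1

theorem HolRep.map_mul (ρ : HolRep) {L L' : C2 →L[ℂ] C2} (h : IsUnit L) (h' : IsUnit L') :
    ρ.map (L * L') = ρ.map L * ρ.map L' := by
  obtain ⟨g, rfl⟩ := h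
  obtain ⟨g', rfl⟩ := h'
  rw [← Units.val_mul, ρ.map_unit, ρ.map_unit, ρ.map_unit, _root_.map_mul, Units.val_mul]

theorem HolRep.contMDiffOn_map (ρ : HolRep) :
    ContMDiffOn 𝓘(ℂ, C2 →L[ℂ] C2) 𝓘(ℂ, C4 →L[ℂ] C4) ω ρ.map {L | IsUnit L} := by
  have hr : {L : C2 →L[ℂ] C2 | IsUnit L} =
      range (Units.val : (C2 →L[ℂ] C2)ˣ → (C2 →L[ℂ] C2)) := by
    ext L
    exact Iff.rfl
  have h1 := contMDiffOn_isOpenEmbedding_symm (I := 𝓘(ℂ, C2 →L[ℂ] C2)) (n := ω)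
    (Units.isOpenEmbedding_val (R := C2 →L[ℂ] C2))
  have h2 := (Units.contMDiff_val (𝕜 := ℂ) (R := C4 →L[ℂ] C4) (n := ω)).comp ρ.holo
  rw [hr]
  refine (h2.comp_contMDiffOn h1).congr ?_
  rintro _ ⟨g, rfl⟩
  rw [ρ.map_unit]
  simp only [Function.comp_apply]
  rw [Topology.IsOpenEmbedding.toOpenPartialHomeomorph_left_inv]

section Bundle

variable (S : Type*) [TopologicalSpace S] [ChartedSpace C2 S] [IsManifold 𝓘(ℂ, C2) ω S]

theorem tangent_isUnit (i j : atlas C2 S) (x : S) (hi : x ∈ i.1.source) (hj : x ∈ j.1.source) :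
    IsUnit ((tangentBundleCore 𝓘(ℂ, C2) S).coordChange i j x) := by
  let Z := tangentBundleCore 𝓘(ℂ, C2) S
  refine ⟨⟨Z.coordChange i j x, Z.coordChange j i x, ?_, ?_⟩, rfl⟩
  · ext1 v
    exact (Z.coordChange_comp j i j x ⟨⟨hj, hi⟩, hj⟩ v).trans (Z.coordChange_self j x hj v)
  · ext1 v
    exact (Z.coordChange_comp i j i x ⟨⟨hi, hj⟩, hi⟩ v).trans (Z.coordChange_self i x hi v)

/-- The vector bundle `Fr(TS) ×_ρ ℂ⁴` associated with the tangent bundle of the complex surface `S`: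
its transition functions are `ρ(g)`, where `g` are the transition functions of `TS`. -/
def assocCore (ρ : HolRep) : VectorBundleCore ℂ S C4 (atlas C2 S) where
  baseSet i := i.1.source
  isOpen_baseSet i := i.1.open_source
  indexAt := achart C2
  mem_baseSet_at := mem_chart_source C2
  coordChange i j x := ρ.map ((tangentBundleCore 𝓘(ℂ, C2) S).coordChange i j x)
  coordChange_self i x hx v := by
    have h : (tangentBundleCore 𝓘(ℂ, C2) S).coordChange i i x = 1 := by
      ext1 w
      exact (tangentBundleCore 𝓘(ℂ, C2) S).coordChange_self i x hx w
    rw [h, ρ.map_one]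
    rfl
  continuousOn_coordChange i j := by
    refine ρ.contMDiffOn_map.continuousOn.comp
      ((tangentBundleCore 𝓘(ℂ, C2) S).continuousOn_coordChange i j) ?_
    intro x hx
    exact tangent_isUnit S i j x hx.1 hx.2
  coordChange_comp i j k x hx v := by
    have h : (tangentBundleCore 𝓘(ℂ, C2) S).coordChange j k x *
        (tangentBundleCore 𝓘(ℂ, C2) S).coordChange i j x =
        (tangentBundleCore 𝓘(ℂ, C2) S).coordChange i k x := by
      ext1 w
      exact (tangentBundleCore 𝓘(ℂ, C2) S).coordChange_comp i j k x hx w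
    rw [← h, ρ.map_mul (tangent_isUnit S j k x hx.1.2 hx.2) (tangent_isUnit S i j x hx.1.1 hx.1.2)]
    rfl

/-- The associated bundle is a holomorphic vector bundle. -/
instance assocCore_isContMDiff (ρ : HolRep) : (assocCore S ρ).IsContMDiff 𝓘(ℂ, C2) ω where
  contMDiffOn_coordChange i j := by
    have : IsManifold 𝓘(ℂ, C2) (ω + 1) S := ‹IsManifold 𝓘(ℂ, C2) ω S›
    have := tangentBundleCore.isContMDiff (I := 𝓘(ℂ, C2)) (M := S) (n := ω)
    refine ρ.contMDiffOn_map.comp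
      ((tangentBundleCore 𝓘(ℂ, C2) S).contMDiffOn_coordChange (n := ω) 𝓘(ℂ, C2) i j) ?_
    intro x hx
    exact tangent_isUnit S i j x hx.1 hx.2

/-- The fibre `V_x`. -/
abbrev V (ρ : HolRep) : S → Type := (assocCore S ρ).Fiber

instance (ρ : HolRep) (x : S) : IsTopologicalAddGroup (V S ρ x) :=
  inferInstanceAs (IsTopologicalAddGroup C4)

instance (ρ : HolRep) (x : S) : ContinuousSMul ℂ (V S ρ x) :=
  inferInstanceAs (ContinuousSMul ℂ C4)

variable {S} {ρ : HolRep}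

/-- The section `s` of `V` is holomorphic on the set `N`. -/
def HoloOn (s : ∀ x, V S ρ x) (N : Set S) : Prop :=
  ContMDiffOn 𝓘(ℂ, C2) (𝓘(ℂ, C2).prod 𝓘(ℂ, C4)) ω (fun x => TotalSpace.mk' C4 x (s x)) N

/-- The section `s` of `V` is (complex) differentiable at `x`. -/
def DiffAt (s : ∀ x, V S ρ x) (x : S) : Prop :=
  MDifferentiableAt 𝓘(ℂ, C2) (𝓘(ℂ, C2).prod 𝓘(ℂ, C4)) (fun y => TotalSpace.mk' C4 y (s y)) x

/-- `s` is a holomorphic frame over `N` of the family of subspaces `U`. -/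
structure IsHoloFrame {k : ℕ} (U : ∀ x, Submodule ℂ (V S ρ x)) (N : Set S)
    (s : Fin k → ∀ x, V S ρ x) : Prop where
  holo : ∀ i, HoloOn (s i) N
  indep : ∀ x ∈ N, LinearIndependent ℂ (fun i => s i x)
  span : ∀ x ∈ N, Submodule.span ℂ (range fun i => s i x) = U x

/-- `U` is a holomorphic subbundle of `V` of rank `k`. -/
def IsHoloSubbundle (k : ℕ) (U : ∀ x, Submodule ℂ (V S ρ x)) : Prop :=
  ∀ x, ∃ N : Set S, IsOpen N ∧ x ∈ N ∧ ∃ s : Fin k → ∀ x, V S ρ x, IsHoloFrame U N s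

/-! ### Conformal Cartan connections -/

variable (S ρ) in
/-- A (complex) conformal Cartan connection `(V, ⟨·,·⟩, Λ, 𝒟)` on a complex surface. -/
structure CartanConnection where
  /-- the complex bilinear inner product on the fibres of `V` -/
  inner : ∀ x, LinearMap.BilinForm ℂ (V S ρ x)
  inner_symm : ∀ x a b, inner x a b = inner x b a
  inner_nondeg : ∀ x, (inner x).Nondegenerate
  inner_holo : ∀ N : Set S, IsOpen N → ∀ s s' : ∀ x, V S ρ x, HoloOn s N → HoloOn s' N →
    ContMDiffOn 𝓘(ℂ, C2) 𝓘(ℂ, ℂ) ω (fun x => inner x (s x) (s' x)) N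
  /-- the null line subbundle -/
  Λ : ∀ x, Submodule ℂ (V S ρ x)
  Λ_subbundle : IsHoloSubbundle 1 Λ
  Λ_null : ∀ x, ∀ a ∈ Λ x, inner x a a = 0
  /-- the linear connection; `D s x v` is `𝒟_v s` at `x` -/
  D : CovariantDerivative 𝓘(ℂ, C2) C4 (V S ρ)
  D_holo : ∀ N : Set S, IsOpen N → ContMDiffCovariantDerivativeOn C4 ω D.toFun N
  D_metric : ∀ (s s' : ∀ x, V S ρ x) (x : S), DiffAt s x → DiffAt s' x →
    ∀ v : TangentSpace 𝓘(ℂ, C2) x,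
      mvfderiv 𝓘(ℂ, C2) (fun y => inner y (s y) (s' y)) x v =
        inner x (D.toFun s x v) (s' x) + inner x (s x) (D.toFun s' x v)
  /-- the isomorphism `ε : TS ⊗ Λ → Λ^⊥ / Λ` of the Cartan condition; the target is realized as the
  image of `Λ^⊥` in `V / Λ` -/
  eps : ∀ x, (TangentSpace 𝓘(ℂ, C2) x ⊗[ℂ] (Λ x)) ≃ₗ[ℂ]
    (((inner x).orthogonal (Λ x)).map (Λ x).mkQ)
  /-- `ε` is `𝒟|_Λ` modulo `Λ` -/
  eps_spec : ∀ (ℓ : ∀ x, V S ρ x) (x : S), DiffAt ℓ x → (∀ᶠ y in 𝓝 x, ℓ y ∈ Λ y) →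
    ∀ (hx : ℓ x ∈ Λ x) (v : TangentSpace 𝓘(ℂ, C2) x),
      (eps x (v ⊗ₜ[ℂ] (⟨ℓ x, hx⟩ : Λ x)) : V S ρ x ⧸ Λ x) = (Λ x).mkQ (D.toFun ℓ x v)

/-- The annihilator `Λ^⊥` of `Λ`. -/
def CartanConnection.perp (𝒞 : CartanConnection S ρ) (x : S) : Submodule ℂ (V S ρ x) :=
  (𝒞.inner x).orthogonal (𝒞.Λ x)

/-- The two signs `+` and `-`. -/
inductive Sgn
  | plus
  | minus

/-- The two null subbundles `U⁺, U⁻ ⊂ Λ^⊥`: rank two holomorphic subbundles whose fibres together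
are the solutions of `⟨a, a⟩ = 0` in `Λ^⊥`, with `U⁺ ∩ U⁻ = Λ`. -/
structure NullSubbundles (𝒞 : CartanConnection S ρ) where
  U : Sgn → ∀ x, Submodule ℂ (V S ρ x)
  subbundle : ∀ e, IsHoloSubbundle 2 (U e)
  le_perp : ∀ e x, U e x ≤ 𝒞.perp x
  null : ∀ x, ∀ a ∈ 𝒞.perp x, 𝒞.inner x a a = 0 ↔ a ∈ U .plus x ∨ a ∈ U .minus x
  inf_eq : ∀ x, U .plus x ⊓ U .minus x = 𝒞.Λ x

namespace NullSubbundles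

variable {𝒞 : CartanConnection S ρ} (ν : NullSubbundles 𝒞)

/-- The line `t^± ⊂ TS` with `ε(t^± ⊗ Λ) = U^± / Λ`. -/
def t (e : Sgn) (x : S) : Submodule ℂ (TangentSpace 𝓘(ℂ, C2) x) where
  carrier := {v | ∀ ℓ : 𝒞.Λ x,
    (𝒞.eps x (v ⊗ₜ[ℂ] ℓ) : V S ρ x ⧸ 𝒞.Λ x) ∈ (ν.U e x).map (𝒞.Λ x).mkQ}
  zero_mem' ℓ := by
    rw [TensorProduct.zero_tmul, map_zero]
    exact Submodule.zero_mem _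
  add_mem' {v w} hv hw ℓ := by
    rw [TensorProduct.add_tmul, map_add]
    exact Submodule.add_mem _ (hv ℓ) (hw ℓ)
  smul_mem' c v hv ℓ := by
    rw [← TensorProduct.smul_tmul', map_smul]
    exact Submodule.smul_mem _ c (hv ℓ)

end NullSubbundles

/-! ### Curves and horizontal lifts -/

/-- The velocity of the complex curve `c` at the parameter `z`. -/
def velocity (c : ℂ → S) (z : ℂ) : TangentSpace 𝓘(ℂ, C2) (c z) :=
  mfderiv 𝓘(ℂ, ℂ) 𝓘(ℂ, C2) c z (1 : ℂ)

variable {𝒞 : CartanConnection S ρ}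

/-- `c : Ω → S` is a curve of the family `C^±`: a (regular, connected) integral curve of `t^±`. -/
structure IsNullCurve (ν : NullSubbundles 𝒞) (e : Sgn) (Ω : Set ℂ) (c : ℂ → S) : Prop where
  isOpen : IsOpen Ω
  isConnected : IsConnected Ω
  holo : ContMDiffOn 𝓘(ℂ, ℂ) 𝓘(ℂ, C2) ω c Ω
  regular : ∀ z ∈ Ω, velocity c z ≠ 0
  tangent : ∀ z ∈ Ω, velocity c z ∈ ν.t e (c z)

/-- The section `u` of `V` along the regular curve `c` satisfies `𝒟_{c'} u = 0` at the parameter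
`z`; the covariant derivative along `c` is computed by extending `u` to a section of `V`. -/
def IsParallelAt (𝒞 : CartanConnection S ρ) (c : ℂ → S) (u : ∀ z, V S ρ (c z)) (z : ℂ) : Prop :=
  ∃ s : ∀ x, V S ρ x, DiffAt s (c z) ∧ (∀ᶠ w in 𝓝 z, s (c w) = u w) ∧
    𝒞.D.toFun s (c z) (velocity c z) = 0

/-- `u` is a horizontal lift to `U^±` of the curve `c : Ω → S`. -/
structure IsHorizontalLift (ν : NullSubbundles 𝒞) (e : Sgn) (Ω : Set ℂ) (c : ℂ → S)
    (u : ∀ z, V S ρ (c z)) : Prop where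
  mem : ∀ z ∈ Ω, u z ∈ ν.U e (c z)
  parallel : ∀ z ∈ Ω, IsParallelAt 𝒞 c u z

/-! ### The bundles `F^± = ℙ(U^±)` and the leaf spaces `T^±` -/

/-- The nonzero vectors of `U` over `W`, as a subspace of the total space of `V`. -/
def NonzeroVec (U : ∀ x, Submodule ℂ (V S ρ x)) (W : Set S) : Type _ :=
  {p : TotalSpace C4 (V S ρ) // p.proj ∈ W ∧ p.2 ∈ U p.proj ∧ p.2 ≠ 0}

instance (U : ∀ x, Submodule ℂ (V S ρ x)) (W : Set S) : TopologicalSpace (NonzeroVec U W) :=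
  instTopologicalSpaceSubtype

/-- The projective bundle `ℙ(U)` over `W`. -/
def ProjBundle (U : ∀ x, Submodule ℂ (V S ρ x)) (W : Set S) : Type _ :=
  Σ x : W, Projectivization ℂ (U x)

/-- The class `[σ, u]` in `ℙ(U)` of a nonzero vector `u ∈ U_σ`. -/
def toProj {U : ∀ x, Submodule ℂ (V S ρ x)} {W : Set S} (p : NonzeroVec U W) : ProjBundle U W :=
  ⟨⟨p.1.proj, p.2.1⟩, Projectivization.mk ℂ (⟨p.1.2, p.2.2.1⟩ : U p.1.proj)
    (fun h => p.2.2.2 (congrArg Subtype.val h))⟩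

instance (U : ∀ x, Submodule ℂ (V S ρ x)) (W : Set S) : TopologicalSpace (ProjBundle U W) :=
  TopologicalSpace.coinduced toProj inferInstance

/-- The part over `W` of the bundle `F^±`. -/
abbrev F (ν : NullSubbundles 𝒞) (e : Sgn) (W : Set S) : Type _ := ProjBundle (ν.U e) W

/-- `p, q ∈ F^±|_W` lie on one horizontally lifted curve of the family `C^±` inside `W`. -/
def OnLift (ν : NullSubbundles 𝒞) (e : Sgn) (W : Set S) (p q : F ν e W) : Prop :=
  ∃ (Ω : Set ℂ) (c : ℂ → S) (u : ∀ z, V S ρ (c z)),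
    IsNullCurve ν e Ω c ∧ IsHorizontalLift ν e Ω c u ∧
    (∀ z ∈ Ω, c z ∈ W ∧ u z ≠ 0) ∧
    ∃ z ∈ Ω, ∃ w ∈ Ω, ∃ P Q : NonzeroVec (ν.U e) W,
      P.1 = TotalSpace.mk' C4 (c z) (u z) ∧ Q.1 = TotalSpace.mk' C4 (c w) (u w) ∧
      toProj P = p ∧ toProj Q = q

/-- The leaf space `T^±` of the foliation of `F^±|_W` by horizontally lifted curves: the leaves are
the classes of the equivalence relation generated by lying on a common lifted curve. -/
def T (ν : NullSubbundles 𝒞) (e : Sgn) (W : Set S) : Type _ := Quot (OnLift ν e W)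

/-- The projection `F^± → T^±`. -/
def toLeaf {ν : NullSubbundles 𝒞} {e : Sgn} {W : Set S} (p : F ν e W) : T ν e W :=
  Quot.mk _ p

instance (ν : NullSubbundles 𝒞) (e : Sgn) (W : Set S) : TopologicalSpace (T ν e W) :=
  TopologicalSpace.coinduced toLeaf inferInstance

/-- `g` is a holomorphic function on the open subset `O` of `F^±|_W`: in every local holomorphic
frame `s` of `U^±` the function `(x, a) ↦ g [a₀ s₀(x) + a₁ s₁(x)]` is holomorphic. -/
def HoloFun (ν : NullSubbundles 𝒞) (e : Sgn) (W : Set S) (O : Set (F ν e W))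
    (g : F ν e W → ℂ) : Prop :=
  ∀ (N : Set S) (s : Fin 2 → ∀ x, V S ρ x), IsOpen N → N ⊆ W → IsHoloFrame (ν.U e) N s →
    ∀ G : S × C2 → ℂ,
      (∀ (P : NonzeroVec (ν.U e) W) (x : S) (a : C2), x ∈ N →
        P.1 = TotalSpace.mk' C4 x (∑ i, a i • s i x) → G (x, a) = g (toProj P)) →
      ContMDiffOn (𝓘(ℂ, C2).prod 𝓘(ℂ, C2)) 𝓘(ℂ, ℂ) ω G
        {y | y.1 ∈ N ∧ ∃ P : NonzeroVec (ν.U e) W,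
          P.1 = TotalSpace.mk' C4 y.1 (∑ i, y.2 i • s i y.1) ∧ toProj P ∈ O}

/-- A holomorphic map between parts of `F^±`: it is continuous and pulls holomorphic functions back
to holomorphic functions. -/
structure IsHoloMapF {ν : NullSubbundles 𝒞} {e : Sgn} {W W' : Set S}
    (Φ : F ν e W → F ν e W') : Prop where
  continuous : Continuous Φ
  pullback : ∀ (O : Set (F ν e W')) (g : F ν e W' → ℂ), IsOpen O →
    HoloFun ν e W' O g → HoloFun ν e W (Φ ⁻¹' O) (g ∘ Φ)

/-- A holomorphic map between leaf spaces: it is continuous and pulls holomorphic functions back to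
holomorphic functions, where a function on an open set of leaves is holomorphic when its pullback
to `F^±` is. -/
structure IsHoloMapT {ν : NullSubbundles 𝒞} {e : Sgn} {W W' : Set S}
    (f : T ν e W → T ν e W') : Prop where
  continuous : Continuous f
  pullback : ∀ (O : Set (T ν e W')) (g : T ν e W' → ℂ), IsOpen O →
    HoloFun ν e W' (toLeaf ⁻¹' O) (g ∘ toLeaf) →
    HoloFun ν e W (toLeaf ⁻¹' (f ⁻¹' O)) ((g ∘ f) ∘ toLeaf)

/-! ### Flows and symmetries -/

/-- A local 1-parameter group of transformations `φ_t` generated by the vector field `X`. -/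
structure LocalFlow (X : ∀ x : S, TangentSpace 𝓘(ℂ, C2) x) where
  /-- the set of the `(t, x)` for which `φ_t(x)` is defined -/
  dom : Set (ℝ × S)
  φ : ℝ → S → S
  isOpen_dom : IsOpen dom
  zero_mem : ∀ x, ((0 : ℝ), x) ∈ dom
  /-- the times for which `φ_t(x)` is defined form an interval -/
  ordConnected : ∀ x, {t : ℝ | (t, x) ∈ dom}.OrdConnected
  φ_zero : ∀ x, φ 0 x = x
  φ_add : ∀ s t x, (s, x) ∈ dom → (t, φ s x) ∈ dom → (t + s, x) ∈ dom →
    φ (t + s) x = φ t (φ s x)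
  smooth : ContMDiffOn (𝓘(ℝ, ℝ).prod 𝓘(ℝ, C2)) 𝓘(ℝ, C2) ∞ (fun p : ℝ × S => φ p.1 p.2) dom
  holo : ∀ t, ContMDiffOn 𝓘(ℂ, C2) 𝓘(ℂ, C2) ω (φ t) {x | (t, x) ∈ dom}
  generates : ∀ t x, (t, x) ∈ dom →
    HasMFDerivAt 𝓘(ℝ, ℝ) 𝓘(ℝ, C2) (fun s => φ s x) t
      (ContinuousLinearMap.toSpanSingleton ℝ (X (φ t x) : C2))

/-- The action `f_* : V_x → V_{f(x)}` on the associated bundle of a map `f` with invertible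
derivative at `x`: `f_* [b, w] = [df ∘ b, w]` for a frame `b` of `T_x S` and `w ∈ ℂ⁴`. The fibres of
`TS` and `V` at a point are identified with `ℂ²` and `ℂ⁴` by the preferred chart at this point, so
this is `ρ(df)`. -/
def push (f : S → S) (x : S) : V S ρ x →ₗ[ℂ] V S ρ (f x) :=
  (ρ.map (mfderiv 𝓘(ℂ, C2) 𝓘(ℂ, C2) f x) : C4 →ₗ[ℂ] C4)

/-- The lift `(σ, v) ↦ (f(σ), f_* v)` of `f` to `V`. -/
def lift (f : S → S) (p : TotalSpace C4 (V S ρ)) : TotalSpace C4 (V S ρ) :=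
  ⟨f p.proj, push f p.proj p.2⟩

/-- The map `f` preserves the Cartan connection at the point `x`. -/
structure PreservesAt (𝒞 : CartanConnection S ρ) (f : S → S) (x : S) : Prop where
  line : (𝒞.Λ x).map (push f x) = 𝒞.Λ (f x)
  inner : ∀ a b, 𝒞.inner (f x) (push f x a) (push f x b) = 𝒞.inner x a b
  /-- `f_*(𝒟_v s) = 𝒟_{f_* v} (f_* s)`; the section `s'` is `f_* s` near `f x` -/
  conn : ∀ s s' : ∀ y, V S ρ y, DiffAt s x → DiffAt s' (f x) →
    (∀ᶠ y in 𝓝 x, s' (f y) = push f y (s y)) →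
    ∀ v : TangentSpace 𝓘(ℂ, C2) x,
      𝒞.D.toFun s' (f x) (mfderiv 𝓘(ℂ, C2) 𝓘(ℂ, C2) f x v) = push f x (𝒞.D.toFun s x v)

/-- The vector field generating the flow is a symmetry of the Cartan connection: locally on `S`, the
connection is preserved by `φ_t` for all sufficiently small `t`. -/
def IsSymmetry (𝒞 : CartanConnection S ρ) {X : ∀ x : S, TangentSpace 𝓘(ℂ, C2) x}
    (fl : LocalFlow X) : Prop :=
  ∀ x : S, ∀ᶠ p : ℝ × S in 𝓝 ((0 : ℝ), x), PreservesAt 𝒞 (fl.φ p.1) p.2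

end Bundle

end CartanSymmetry

end

open CartanSymmetry

set_option linter.unusedSectionVars false

noncomputable section

namespace CartanSymmetry

section Flow

variable {S : Type*} [TopologicalSpace S] [ChartedSpace C2 S] [IsManifold 𝓘(ℂ, C2) ω S]
  {ρ : HolRep}

/-! ### Germs of biholomorphic maps and their derivatives -/

/-! Everything is done with germs. `LocIso` is a germ of a biholomorphism together with its inverse
germ, and `Sym` adds that it preserves at one point the line, the metric, the connection and each of
the two null subbundles. `Sym` is stable under composition and inversion. The last condition is not
part of the notion of symmetry: the metric and `Λ` determine only the unordered pair of null
subbundles, so a symmetry could exchange them.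

For small times the exchange is excluded by continuity (`LocalFlow.eventually_sym`). Take sections
of the two subbundles that lie outside `Λ` at a point, push the first forward by the flow and pair
it with the second. At time zero the pairing is nonzero, since otherwise the sum of the two vectors
would be a null vector of `Λ^⊥` in neither subbundle. If the subbundles were exchanged, both vectors
would lie in one totally null subspace and the pairing would vanish. Continuity in time and point
needs the differential of the flow to be jointly continuous, which comes from its real smoothness
(`LocalFlow.continuousAt_coordD`).

For arbitrary times, `LocalFlow.exists_sym` uses the group law on germs: whether the germ at time
`s` is a symmetry is locally constant in `s`, and the times at which the flow through a point is
defined form an interval containing zero.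

A symmetry carries `t^±` to `t^±` because `ε` is built from `𝒟` modulo `Λ`, and it carries parallel
sections to parallel sections. Null curves and their horizontal lifts are therefore preserved, and
the map of `F^±` descends to leaves. Its holomorphy is tested in frames pushed forward by the map,
where the coefficients of a vector do not change. Inverses come from the same construction applied
to the inverse map, which is again a symmetry. -/

/-- The derivative of `f` at `x`, with the tangent spaces identified with `ℂ²`. -/
def dl (f : S → S) (x : S) : C2 →L[ℂ] C2 := mfderiv 𝓘(ℂ, C2) 𝓘(ℂ, C2) f x

/-- `f` and `g` are mutually inverse biholomorphic germs at `x` and `y`. -/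
structure LocIso (f g : S → S) (x y : S) : Prop where
  map_eq : f x = y
  inv_eq : g y = x
  holo : ContMDiffAt 𝓘(ℂ, C2) 𝓘(ℂ, C2) ω f x
  inv_holo : ContMDiffAt 𝓘(ℂ, C2) 𝓘(ℂ, C2) ω g y
  left_inv : ∀ᶠ x' in 𝓝 x, g (f x') = x'
  right_inv : ∀ᶠ y' in 𝓝 y, f (g y') = y'

theorem dl_congr {f f' : S → S} {x : S} (h : f =ᶠ[𝓝 x] f') : dl f x = dl f' x :=
  h.mfderiv_eq

theorem dl_id (x : S) : dl (id : S → S) x = 1 := mfderiv_id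

theorem dl_comp {f g : S → S} {x y : S} (hy : f x = y)
    (hf : MDifferentiableAt 𝓘(ℂ, C2) 𝓘(ℂ, C2) f x)
    (hg : MDifferentiableAt 𝓘(ℂ, C2) 𝓘(ℂ, C2) g y) : dl (g ∘ f) x = dl g y * dl f x := by
  subst hy
  exact mfderiv_comp x hg hf

namespace LocIso

variable {f g f' g' : S → S} {x y z : S}

theorem symm (h : LocIso f g x y) : LocIso g f y x :=
  ⟨h.inv_eq, h.map_eq, h.inv_holo, h.holo, h.right_inv, h.left_inv⟩

theorem tendsto (h : LocIso f g x y) : Tendsto f (𝓝 x) (𝓝 y) := by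
  have := h.holo.continuousAt.tendsto
  rwa [h.map_eq] at this

theorem congr (h : LocIso f g x y) (hf : f' =ᶠ[𝓝 x] f) (hg : g' =ᶠ[𝓝 y] g) :
    LocIso f' g' x y where
  map_eq := hf.self_of_nhds.trans h.map_eq
  inv_eq := hg.self_of_nhds.trans h.inv_eq
  holo := h.holo.congr_of_eventuallyEq hf
  inv_holo := h.inv_holo.congr_of_eventuallyEq hg
  left_inv := by
    filter_upwards [h.left_inv, hf, h.tendsto.eventually hg] with x' h1 h2 h3
    rw [h2, h3, h1]
  right_inv := by
    filter_upwards [h.right_inv, hg, h.symm.tendsto.eventually hf] with x' h1 h2 h3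
    rw [h2, h3, h1]

theorem comp (h : LocIso f g x y) (h' : LocIso f' g' y z) : LocIso (f' ∘ f) (g ∘ g') x z where
  map_eq := by simp [h.map_eq, h'.map_eq]
  inv_eq := by simp [h.inv_eq, h'.inv_eq]
  holo := by
    have := h'.holo
    rw [← h.map_eq] at this
    exact this.comp x h.holo
  inv_holo := by
    have := h.inv_holo
    rw [← h'.inv_eq] at this
    exact this.comp z h'.inv_holo
  left_inv := by
    filter_upwards [h.left_inv, h.tendsto.eventually h'.left_inv] with x' h1 h2
    simp [h1, h2]
  right_inv := by
    filter_upwards [h'.right_inv, h'.symm.tendsto.eventually h.right_inv] with x' h1 h2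
    simp [h1, h2]

theorem eventually (h : LocIso f g x y) : ∀ᶠ x' in 𝓝 x, LocIso f g x' (f x') := by
  have h1 := (contMDiffAt_iff_contMDiffAt_nhds (n := ω) (by simp)).1 h.holo
  have h2 := (contMDiffAt_iff_contMDiffAt_nhds (n := ω) (by simp)).1 h.inv_holo
  filter_upwards [h1, h.tendsto.eventually h2, h.left_inv.eventually_nhds,
    h.tendsto.eventually h.right_inv.eventually_nhds] with x' a b c d
  exact ⟨rfl, c.self_of_nhds, a, b, c, d⟩

theorem mdiff (h : LocIso f g x y) : MDifferentiableAt 𝓘(ℂ, C2) 𝓘(ℂ, C2) f x :=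
  h.holo.mdifferentiableAt (by simp)

theorem dl_mul (h : LocIso f g x y) : dl g y * dl f x = 1 := by
  rw [← dl_comp h.map_eq h.mdiff h.symm.mdiff, ← dl_id x]
  exact dl_congr h.left_inv

theorem dl_apply (h : LocIso f g x y) (v : C2) : dl g y (dl f x v) = v :=
  DFunLike.congr_fun h.dl_mul v

theorem isUnit (h : LocIso f g x y) : IsUnit (dl f x) :=
  ⟨⟨dl f x, dl g y, h.symm.dl_mul, h.dl_mul⟩, rfl⟩

end LocIso

/-! ### The lift to the associated bundle -/

/-- `ρ(df)` as a map from `V_x` to `V_y`, which is the push-forward if `f x = y`. -/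
def pushTo (ρ : HolRep) (f : S → S) (x y : S) : V S ρ x →ₗ[ℂ] V S ρ y :=
  (ρ.map (dl f x) : C4 →ₗ[ℂ] C4)

theorem pushTo_congr {f f' : S → S} {x : S} (y : S) (h : f =ᶠ[𝓝 x] f') :
    pushTo ρ f x y = pushTo ρ f' x y := by
  rw [pushTo, dl_congr h, pushTo]

namespace LocIso

variable {f g f' g' : S → S} {x y z : S}

theorem pushTo_comp (h : LocIso f g x y) (h' : LocIso f' g' y z) (a : V S ρ x) :
    pushTo ρ (f' ∘ f) x z a = pushTo ρ f' y z (pushTo ρ f x y a) := by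
  change ρ.map (dl (f' ∘ f) x) a = ρ.map (dl f' y) (ρ.map (dl f x) a)
  rw [dl_comp h.map_eq h.mdiff h'.mdiff, ρ.map_mul h'.isUnit h.isUnit]
  rfl

theorem pushTo_inv (h : LocIso f g x y) (a : V S ρ x) :
    pushTo ρ g y x (pushTo ρ f x y a) = a := by
  change ρ.map (dl g y) (ρ.map (dl f x) a) = a
  have := ρ.map_mul h.symm.isUnit h.isUnit
  rw [h.dl_mul, ρ.map_one] at this
  exact (DFunLike.congr_fun this a).symm

theorem pushTo_bijective (h : LocIso f g x y) : Function.Bijective (pushTo ρ f x y) :=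
  Function.bijective_iff_has_inverse.2 ⟨pushTo ρ g y x, h.pushTo_inv, h.symm.pushTo_inv⟩

end LocIso

theorem lift_congr {f f' : S → S} {x : S} (h : f =ᶠ[𝓝 x] f') (a : V S ρ x) :
    lift f (TotalSpace.mk' C4 x a) = lift f' (TotalSpace.mk' C4 x a) := by
  -- The target fibre depends on the base point, so base point and derivative are generalized before
  -- being identified; all fibres are definitionally `ℂ⁴`.
  have key : ∀ y y' : S, ∀ L L' : C2 →L[ℂ] C2, y = y' → L = L' →
      (⟨y, (ρ.map L : C4 → C4) a⟩ : TotalSpace C4 (V S ρ)) = ⟨y', (ρ.map L' : C4 → C4) a⟩ := by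
    rintro y _ L _ rfl rfl
    rfl
  exact key _ _ _ _ h.self_of_nhds (dl_congr h)

theorem lift_eq_mk {f : S → S} {x y : S} (hy : f x = y) (a : V S ρ x) :
    lift f (TotalSpace.mk' C4 x a) = TotalSpace.mk' C4 y (pushTo ρ f x y a) := by
  subst hy
  rfl

theorem LocIso.lift_lift {f g : S → S} {x y : S} (h : LocIso f g x y) (a : V S ρ x) :
    lift g (lift f (TotalSpace.mk' C4 x a)) = TotalSpace.mk' C4 x a := by
  rw [lift_eq_mk h.map_eq, lift_eq_mk h.inv_eq, h.pushTo_inv]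

/-- The derivative of `f` at `x` in the preferred charts at `x₀` and `y₀`. -/
def coordD (x₀ y₀ : S) (f : S → S) (x : S) : C2 →L[ℂ] C2 :=
  tangentCoordChange 𝓘(ℂ, C2) (f x) y₀ (f x) * dl f x * tangentCoordChange 𝓘(ℂ, C2) x₀ x x

theorem isUnit_tangentCoordChange {x y z : S} (hx : z ∈ (chartAt C2 x).source)
    (hy : z ∈ (chartAt C2 y).source) : IsUnit (tangentCoordChange 𝓘(ℂ, C2) x y z) :=
  tangent_isUnit S (achart C2 x) (achart C2 y) z hx hy

theorem isUnit_coordD {x₀ y₀ x : S} {f : S → S} (hx : x ∈ (chartAt C2 x₀).source)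
    (hy : f x ∈ (chartAt C2 y₀).source) (hu : IsUnit (dl f x)) : IsUnit (coordD x₀ y₀ f x) :=
  ((isUnit_tangentCoordChange (mem_chart_source _ _) hy).mul hu).mul
    (isUnit_tangentCoordChange hx (mem_chart_source _ _))

/-- The transition maps of `V` are `ρ` of those of `TS`, and `ρ.map` is multiplicative on invertible
maps, so the three factors of `coordD` combine and the chart change at the source cancels. -/
theorem trivializationAt_lift {x₀ y₀ x : S} {f : S → S} (hx : x ∈ (chartAt C2 x₀).source)
    (hy : f x ∈ (chartAt C2 y₀).source) (hu : IsUnit (dl f x)) (a : V S ρ x) :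
    (trivializationAt C4 (V S ρ) y₀ (lift f (TotalSpace.mk' C4 x a))).2 =
      ρ.map (coordD x₀ y₀ f x) (trivializationAt C4 (V S ρ) x₀ (TotalSpace.mk' C4 x a)).2 := by
  change ρ.map (tangentCoordChange 𝓘(ℂ, C2) (f x) y₀ (f x)) (ρ.map (dl f x) a) =
    ρ.map (coordD x₀ y₀ f x) (ρ.map (tangentCoordChange 𝓘(ℂ, C2) x x₀ x) a)
  have h1 := isUnit_tangentCoordChange (mem_chart_source C2 (f x)) hy
  have h2 := isUnit_tangentCoordChange hx (mem_chart_source C2 x)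
  have h3 := isUnit_tangentCoordChange (mem_chart_source C2 x) hx
  have h4 : tangentCoordChange 𝓘(ℂ, C2) x₀ x x * tangentCoordChange 𝓘(ℂ, C2) x x₀ x = 1 := by
    ext1 v
    change tangentCoordChange 𝓘(ℂ, C2) x₀ x x (tangentCoordChange 𝓘(ℂ, C2) x x₀ x v) = v
    rw [tangentCoordChange_comp, tangentCoordChange_self] <;> simp [hx]
  have h5 := ρ.map_mul (isUnit_coordD hx hy hu) h3
  rw [coordD, mul_assoc, h4, mul_one, ρ.map_mul h1 hu] at h5
  exact DFunLike.congr_fun h5 a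

theorem HolRep.contMDiffAt_map (ρ : HolRep) {L : C2 →L[ℂ] C2} (h : IsUnit L) :
    ContMDiffAt 𝓘(ℂ, C2 →L[ℂ] C2) 𝓘(ℂ, C4 →L[ℂ] C4) ω ρ.map L :=
  ρ.contMDiffOn_map.contMDiffAt (Units.isOpen.mem_nhds h)

/-- Near `x`, `coordD` is the derivative read in tangent coordinates, and an analytic map has an
analytic derivative. -/
theorem contMDiffAt_coordD {f : S → S} {x : S} (h : ContMDiffAt 𝓘(ℂ, C2) 𝓘(ℂ, C2) ω f x) :
    ContMDiffAt 𝓘(ℂ, C2) 𝓘(ℂ, C2 →L[ℂ] C2) ω (coordD x (f x) f) x := by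
  refine (h.mfderiv_const (m := ω) (by simp)).congr_of_eventuallyEq ?_
  filter_upwards [(chartAt C2 x).open_source.mem_nhds (mem_chart_source C2 x),
    h.continuousAt ((chartAt C2 (f x)).open_source.mem_nhds (mem_chart_source C2 (f x)))]
    with x' h1 h2
  exact (inTangentCoordinates_eq (I := 𝓘(ℂ, C2)) (I' := 𝓘(ℂ, C2)) id f (dl f) h1 h2).symm

theorem LocIso.contMDiffAt_lift {f g : S → S} {y : S} {p : TotalSpace C4 (V S ρ)}
    (h : LocIso f g p.proj y) :
    ContMDiffAt (𝓘(ℂ, C2).prod 𝓘(ℂ, C4)) (𝓘(ℂ, C2).prod 𝓘(ℂ, C4)) ω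
      (lift f : TotalSpace C4 (V S ρ) → TotalSpace C4 (V S ρ)) p := by
  have hpr : ContMDiffAt (𝓘(ℂ, C2).prod 𝓘(ℂ, C4)) 𝓘(ℂ, C2) ω
      (TotalSpace.proj : TotalSpace C4 (V S ρ) → S) p := contMDiff_proj _ p
  have hp := hpr.continuousAt.tendsto
  have hid := contMDiffAt_totalSpace.1 (contMDiffAt_id (I := 𝓘(ℂ, C2).prod 𝓘(ℂ, C4)) (n := ω)
    (x := p))
  refine contMDiffAt_totalSpace.2 ⟨h.holo.comp p hpr, ?_⟩
  have h1 := (contMDiffAt_coordD h.holo).comp p hpr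
  have hu : IsUnit (coordD p.proj (f p.proj) f p.proj) :=
    isUnit_coordD (mem_chart_source _ _) (mem_chart_source _ _) h.isUnit
  have h2 := ((ρ.contMDiffAt_map hu).comp p h1).clm_apply hid.2
  refine h2.congr_of_eventuallyEq ?_
  filter_upwards [hp.eventually ((chartAt C2 p.proj).open_source.mem_nhds (mem_chart_source C2 _)),
    hp.eventually (h.holo.continuousAt ((chartAt C2 (f p.proj)).open_source.mem_nhds
      (mem_chart_source C2 _))), hp.eventually h.eventually] with q h1 h2 h3
  exact trivializationAt_lift h1 h2 h3.isUnit q.2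

/-! ### Push-forward of sections -/

/-- The section `f_* s`, where `g` is the inverse of `f`. -/
def pushSec (f g : S → S) (s : ∀ x, V S ρ x) (y : S) : V S ρ y := pushTo ρ f (g y) y (s (g y))

namespace LocIso

variable {f g : S → S} {x y : S}

theorem pushSec_apply (h : LocIso f g x y) (s : ∀ x, V S ρ x) :
    pushSec f g s y = pushTo ρ f x y (s x) := by
  have hx := h.inv_eq
  subst hx
  rfl

theorem pushSec_map (h : LocIso f g x y) (s : ∀ x, V S ρ x) :
    ∀ᶠ x' in 𝓝 x, pushSec f g s (f x') = push f x' (s x') := by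
  filter_upwards [h.eventually] with x' hx'
  exact hx'.pushSec_apply s

theorem mk_pushSec (h : LocIso f g x y) (s : ∀ x, V S ρ x) :
    TotalSpace.mk' C4 y (pushSec f g s y) = lift f (TotalSpace.mk' C4 (g y) (s (g y))) := by
  have hx := h.inv_eq
  subst hx
  rw [lift_eq_mk h.map_eq]
  rfl

theorem mk_pushSec_eventuallyEq (h : LocIso f g x y) (s : ∀ x, V S ρ x) :
    (fun y' => TotalSpace.mk' C4 y' (pushSec f g s y')) =ᶠ[𝓝 y]
      fun y' => lift f (TotalSpace.mk' C4 (g y') (s (g y'))) := by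
  filter_upwards [h.symm.eventually] with y' hy'
  exact hy'.symm.mk_pushSec s

theorem diffAt_pushSec (h : LocIso f g x y) {s : ∀ x, V S ρ x} (hs : DiffAt s x) :
    DiffAt (pushSec f g s) y := by
  have hx := h.inv_eq
  subst hx
  refine MDifferentiableAt.congr_of_eventuallyEq ?_ (h.mk_pushSec_eventuallyEq s)
  have h1 := (h.contMDiffAt_lift (ρ := ρ) (p := TotalSpace.mk' C4 (g y) (s (g y)))).mdifferentiableAt
    (by simp)
  exact MDifferentiableAt.comp y (g := lift f) (f := fun y' => TotalSpace.mk' C4 (g y') (s (g y')))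
    h1 (MDifferentiableAt.comp y (g := fun x => TotalSpace.mk' C4 x (s x)) (f := g) hs
      h.symm.mdiff)

theorem contMDiffAt_pushSec (h : LocIso f g x y) {s : ∀ x, V S ρ x}
    (hs : ContMDiffAt 𝓘(ℂ, C2) (𝓘(ℂ, C2).prod 𝓘(ℂ, C4)) ω (fun x => TotalSpace.mk' C4 x (s x)) x) :
    ContMDiffAt 𝓘(ℂ, C2) (𝓘(ℂ, C2).prod 𝓘(ℂ, C4)) ω
      (fun y' => TotalSpace.mk' C4 y' (pushSec f g s y')) y := by
  have hx := h.inv_eq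
  subst hx
  refine ContMDiffAt.congr_of_eventuallyEq ?_ (h.mk_pushSec_eventuallyEq s)
  exact ContMDiffAt.comp y (g := lift f) (f := fun y' => TotalSpace.mk' C4 (g y') (s (g y')))
    (h.contMDiffAt_lift (ρ := ρ) (p := TotalSpace.mk' C4 (g y) (s (g y))))
    (ContMDiffAt.comp y (g := fun x => TotalSpace.mk' C4 x (s x)) (f := g) hs h.inv_holo)

end LocIso

section

/-! ### Local symmetries of the Cartan connection -/

variable {𝒞 : CartanConnection S ρ}

/-- `f` and `g` are mutually inverse germs at `x` and `y` and `f` preserves at `x` the Cartan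
connection and the null subbundles. -/
structure Sym (ν : NullSubbundles 𝒞) (f g : S → S) (x y : S) : Prop extends LocIso f g x y where
  line : (𝒞.Λ x).map (pushTo ρ f x y) = 𝒞.Λ y
  inner : ∀ a b, 𝒞.inner y (pushTo ρ f x y a) (pushTo ρ f x y b) = 𝒞.inner x a b
  conn : ∀ s s' : ∀ y, V S ρ y, DiffAt s x → DiffAt s' y →
    (∀ᶠ x' in 𝓝 x, s' (f x') = push f x' (s x')) →
    ∀ v : C2, 𝒞.D.toFun s' y (dl f x v) = pushTo ρ f x y (𝒞.D.toFun s x v)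
  null : ∀ e, (ν.U e x).map (pushTo ρ f x y) = ν.U e y

namespace Sym

variable {ν : NullSubbundles 𝒞} {f g f' g' : S → S} {x y z : S}

theorem _root_.CartanSymmetry.LocIso.map_symm (h : LocIso f g x y) {A : Submodule ℂ (V S ρ x)}
    {B : Submodule ℂ (V S ρ y)} (hAB : A.map (pushTo ρ f x y) = B) :
    B.map (pushTo ρ g y x) = A := by
  subst hAB
  rw [← Submodule.map_comp]
  have : pushTo ρ g y x ∘ₗ pushTo ρ f x y = LinearMap.id := by
    ext1 a
    exact h.pushTo_inv a
  rw [this, Submodule.map_id]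

theorem _root_.CartanSymmetry.LocIso.map_comp (h : LocIso f g x y) (h' : LocIso f' g' y z)
    (A : Submodule ℂ (V S ρ x)) :
    A.map (pushTo ρ (f' ∘ f) x z) = (A.map (pushTo ρ f x y)).map (pushTo ρ f' y z) := by
  rw [← Submodule.map_comp]
  congr 1
  ext1 a
  exact h.pushTo_comp h' a

theorem symm (h : Sym ν f g x y) : Sym ν g f y x where
  toLocIso := h.toLocIso.symm
  line := h.map_symm h.line
  inner a b := by
    rw [← h.inner, h.toLocIso.symm.pushTo_inv, h.toLocIso.symm.pushTo_inv]
  conn s s' hs hs' hss v := by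
    -- The roles of the two sections are exchanged: near `x`, `s'` is carried by `f` to `s`.
    have key := h.conn s' s hs' hs (by
      filter_upwards [h.tendsto.eventually hss, h.eventually] with x' h1 h2
      have h3 : (s' x' : C4) = pushTo ρ g (f x') x' (s (f x')) := by
        have h4 : (s' (g (f x')) : C4) = s' x' := congrArg (fun z => (s' z : C4)) h2.inv_eq
        exact h4.symm.trans h1
      have h5 := h2.symm.pushTo_inv (ρ := ρ) (s (f x'))
      exact (h5.symm.trans (congrArg (pushTo ρ f x' (f x')) h3.symm)))
      (dl g y v)
    rw [h.toLocIso.symm.dl_apply] at key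
    rw [key, h.pushTo_inv]
  null e := h.map_symm (h.null e)

theorem comp (h : Sym ν f g x y) (h' : Sym ν f' g' y z) : Sym ν (f' ∘ f) (g ∘ g') x z where
  toLocIso := h.toLocIso.comp h'.toLocIso
  line := by rw [h.map_comp h'.toLocIso, h.line, h'.line]
  inner a b := by
    rw [h.pushTo_comp h'.toLocIso, h.pushTo_comp h'.toLocIso, h'.inner, h.inner]
  conn s s' hs hs' hss v := by
    rw [dl_comp h.map_eq h.mdiff h'.mdiff, h.pushTo_comp h'.toLocIso]
    -- The section `f_* s` mediates between the two compatibilities with `𝒟`.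
    rw [← h.conn s (pushSec f g s) hs (h.diffAt_pushSec hs) (h.pushSec_map s)]
    refine h'.conn (pushSec f g s) s' (h.diffAt_pushSec hs) hs' ?_ (dl f x v)
    filter_upwards [h.toLocIso.symm.tendsto.eventually hss, h.toLocIso.symm.eventually,
      h'.eventually] with y' h1 h2 h3
    have h4 : (s' (f' y') : C4) = s' ((f' ∘ f) (g y')) := by
      rw [Function.comp_apply, h2.inv_eq]
    refine h4.trans (h1.trans ?_)
    exact h2.symm.pushTo_comp h3 (s (g y'))
  null e := by rw [h.map_comp h'.toLocIso, h.null, h'.null]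

theorem congr (h : Sym ν f g x y) (hf : f' =ᶠ[𝓝 x] f) (hg : g' =ᶠ[𝓝 y] g) :
    Sym ν f' g' x y where
  toLocIso := h.toLocIso.congr hf hg
  line := by rw [pushTo_congr y hf, h.line]
  inner := by rw [pushTo_congr y hf]; exact h.inner
  conn s s' hs hs' hss := by
    rw [pushTo_congr y hf, dl_congr hf]
    refine h.conn s s' hs hs' ?_
    filter_upwards [hss, hf.eventually_nhds] with x' h1 h2
    have h3 : (s' (f' x') : C4) = s' (f x') := by rw [h2.self_of_nhds]
    refine h3.symm.trans (h1.trans ?_)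
    exact DFunLike.congr_fun (pushTo_congr (ρ := ρ) (f x') h2) (s x')
  null e := by rw [pushTo_congr y hf, h.null]

end Sym

namespace NullSubbundles

variable (ν : NullSubbundles 𝒞)

theorem line_le (e : Sgn) (x : S) : 𝒞.Λ x ≤ ν.U e x := by
  rw [← ν.inf_eq x]
  cases e
  exacts [inf_le_left, inf_le_right]

end NullSubbundles

/-- `f` is near every point of `W` a symmetry of the Cartan connection. -/
def SymOn (ν : NullSubbundles 𝒞) (f : S → S) (W : Set S) : Prop :=
  ∀ x ∈ W, ∃ g, Sym ν f g x (f x)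

/-- Constant coefficients in a holomorphic frame extend the given vector. -/
theorem exists_section {k : ℕ} {U : ∀ x, Submodule ℂ (V S ρ x)} (hU : IsHoloSubbundle k U) (x : S)
    (a : V S ρ x) (ha : a ∈ U x) :
    ∃ (N : Set S) (s : ∀ x, V S ρ x), IsOpen N ∧ x ∈ N ∧ HoloOn s N ∧ (∀ y ∈ N, s y ∈ U y) ∧
      s x = a := by
  obtain ⟨N, hN, hx, s, hs⟩ := hU x
  rw [← hs.span x hx, Submodule.mem_span_range_iff_exists_fun] at ha
  obtain ⟨c, hc⟩ := ha
  refine ⟨N, fun y => ∑ i, c i • s i y, hN, hx, ?_, fun y hy => ?_, hc⟩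
  · exact ContMDiffOn.sum_section fun i _ => (hs.holo i).const_smul_section
  · rw [← hs.span y hy]
    exact Submodule.sum_mem _ fun i _ => Submodule.smul_mem _ _ (Submodule.subset_span ⟨i, rfl⟩)

theorem HoloOn.diffAt {s : ∀ x, V S ρ x} {N : Set S} (hs : HoloOn s N) (hN : IsOpen N) {x : S}
    (hx : x ∈ N) : DiffAt s x :=
  (hs.contMDiffAt (hN.mem_nhds hx)).mdifferentiableAt (by simp)

namespace Sym

variable {ν : NullSubbundles 𝒞} {f g : S → S} {x y : S}

/-- `ε` can be computed from any local section of `Λ`. The hypothesis at nearby points is needed so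
that the pushed section lies in `Λ` on a whole neighbourhood of `y`, not just at `y`. -/
theorem dl_mem_t (h : Sym ν f g x y) (hev : ∀ᶠ x' in 𝓝 x, ∃ g', Sym ν f g' x' (f x')) (e : Sgn)
    {v : C2} (hv : v ∈ ν.t e x) : dl f x v ∈ ν.t e y := by
  rintro ⟨ℓ', hℓ'⟩
  have h1 := hℓ'
  rw [← h.line] at h1
  obtain ⟨ℓ, hℓ, rfl⟩ := h1
  obtain ⟨N, σ, hN, hxN, hσ, hσm, hσx⟩ := exists_section 𝒞.Λ_subbundle x ℓ hℓ
  subst hσx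
  have hd := hσ.diffAt hN hxN
  have hd' := h.diffAt_pushSec hd
  have hy : pushSec f g σ y = pushTo ρ f x y (σ x) := h.pushSec_apply σ
  have hm : ∀ᶠ y' in 𝓝 y, pushSec f g σ y' ∈ 𝒞.Λ y' := by
    filter_upwards [h.toLocIso.symm.tendsto.eventually hev,
      h.toLocIso.symm.tendsto.eventually (hN.mem_nhds hxN), h.right_inv] with y' h1 h2 h3
    obtain ⟨g', hg'⟩ := h1
    rw [h3] at hg'
    rw [← hg'.line]
    exact Submodule.mem_map_of_mem (hσm _ h2)
  have e1 := 𝒞.eps_spec σ x hd (by filter_upwards [hN.mem_nhds hxN] using hσm) hℓ v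
  have e2 := 𝒞.eps_spec (pushSec f g σ) y hd' hm (hy ▸ hℓ') (dl f x v)
  simp only [hy] at e2
  rw [e2, h.conn σ (pushSec f g σ) hd hd' (h.pushSec_map σ) v]
  have h2 := hv ⟨σ x, hℓ⟩
  rw [e1] at h2
  -- The representative `u` differs from `𝒟_v σ` by an element of `Λ ⊂ U^±`, so `𝒟_v σ` is itself in
  -- `U^±`.
  obtain ⟨u, hu, hu'⟩ := h2
  refine Submodule.mem_map_of_mem ?_
  rw [← h.null e]
  refine Submodule.mem_map_of_mem ?_
  rw [Submodule.mkQ_apply, Submodule.mkQ_apply, Submodule.Quotient.eq] at hu'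
  have := sub_mem hu (ν.line_le e x hu')
  rwa [sub_sub_cancel] at this

end Sym

/-! ### Horizontal lifts of curves -/

theorem velocity_comp {f g : S → S} {c : ℂ → S} {z : ℂ} (h : LocIso f g (c z) (f (c z)))
    (hc : MDifferentiableAt 𝓘(ℂ, ℂ) 𝓘(ℂ, C2) c z) :
    velocity (fun z => f (c z)) z = dl f (c z) (velocity c z) :=
  DFunLike.congr_fun (mfderiv_comp z h.mdiff hc) (1 : ℂ)

namespace SymOn

variable {ν : NullSubbundles 𝒞} {f g : S → S} {W W' : Set S} {e : Sgn}

theorem eventually (hf : SymOn ν f W) (hW : IsOpen W) {x : S} (hx : x ∈ W) :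
    ∀ᶠ x' in 𝓝 x, ∃ g', Sym ν f g' x' (f x') := by
  filter_upwards [hW.mem_nhds hx] using hf

theorem isNullCurve (hf : SymOn ν f W) (hW : IsOpen W) {Ω : Set ℂ} {c : ℂ → S}
    (hc : IsNullCurve ν e Ω c) (hcW : ∀ z ∈ Ω, c z ∈ W) :
    IsNullCurve ν e Ω (fun z => f (c z)) := by
  have hat : ∀ z ∈ Ω, ContMDiffAt 𝓘(ℂ, ℂ) 𝓘(ℂ, C2) ω c z := fun z hz =>
    hc.holo.contMDiffAt (hc.isOpen.mem_nhds hz)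
  have hv : ∀ z ∈ Ω, velocity (fun z => f (c z)) z = dl f (c z) (velocity c z) := fun z hz => by
    obtain ⟨g, hg⟩ := hf _ (hcW z hz)
    exact velocity_comp hg.toLocIso ((hat z hz).mdifferentiableAt (by simp))
  refine ⟨hc.isOpen, hc.isConnected, fun z hz => ?_, fun z hz h0 => ?_, fun z hz => ?_⟩
  · obtain ⟨g, hg⟩ := hf _ (hcW z hz)
    exact (hg.holo.comp z (hat z hz)).contMDiffWithinAt
  · obtain ⟨g, hg⟩ := hf _ (hcW z hz)
    rw [hv z hz] at h0
    exact hc.regular z hz ((hg.dl_apply _).symm.trans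
      ((congrArg (dl g (f (c z))) h0).trans (map_zero (dl g (f (c z))))))
  · obtain ⟨g, hg⟩ := hf _ (hcW z hz)
    rw [hv z hz]
    exact hg.dl_mem_t (hf.eventually hW (hcW z hz)) e (hc.tangent z hz)

/-- An extension of `u` off the curve pushes forward to an extension of `f_* u`, and `f_*`
intertwines the covariant derivatives. -/
theorem isHorizontalLift (hf : SymOn ν f W) {Ω : Set ℂ} {c : ℂ → S}
    (hc : IsNullCurve ν e Ω c) {u : ∀ z, V S ρ (c z)} (hu : IsHorizontalLift ν e Ω c u)
    (hcW : ∀ z ∈ Ω, c z ∈ W) :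
    IsHorizontalLift ν e Ω (fun z => f (c z)) (fun z => push f (c z) (u z)) := by
  refine ⟨fun z hz => ?_, fun z hz => ?_⟩
  · obtain ⟨g, hg⟩ := hf _ (hcW z hz)
    rw [← hg.null e]
    exact Submodule.mem_map_of_mem (hu.mem z hz)
  · obtain ⟨g, hg⟩ := hf _ (hcW z hz)
    obtain ⟨s, hs, hsu, hD⟩ := hu.parallel z hz
    have hat := hc.holo.contMDiffAt (hc.isOpen.mem_nhds hz)
    refine ⟨pushSec f g s, hg.diffAt_pushSec hs, ?_, ?_⟩
    · filter_upwards [hsu, hat.continuousAt.eventually (hg.pushSec_map s)] with w h1 h2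
      rw [h2, h1]
    · rw [velocity_comp hg.toLocIso (hat.mdifferentiableAt (by simp))]
      refine (hg.conn s (pushSec f g s) hs (hg.diffAt_pushSec hs) (hg.pushSec_map s) _).trans ?_
      exact (congrArg (pushTo ρ f (c z) (f (c z))) hD).trans (map_zero _)

end SymOn

end

section

/-! ### The induced maps of the projective bundles and of the leaf spaces -/

variable {𝒞 : CartanConnection S ρ} {ν : NullSubbundles 𝒞} {e : Sgn}

theorem toProj_surjective {U : ∀ x, Submodule ℂ (V S ρ x)} {W : Set S} :
    Function.Surjective (toProj : NonzeroVec U W → ProjBundle U W) := by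
  rintro ⟨x, v⟩
  induction v using Projectivization.ind with
  | h v hv =>
    exact ⟨⟨TotalSpace.mk' C4 x.1 v.1, x.2, v.2, fun h => hv (Subtype.ext h)⟩, rfl⟩

theorem continuous_toProj {U : ∀ x, Submodule ℂ (V S ρ x)} {W : Set S} :
    Continuous (toProj : NonzeroVec U W → ProjBundle U W) :=
  continuous_coinduced_rng

theorem continuous_toLeaf {W : Set S} : Continuous (toLeaf : F ν e W → T ν e W) :=
  continuous_coinduced_rng

theorem IsHoloFrame.sum_mem {k : ℕ} {U : ∀ x, Submodule ℂ (V S ρ x)} {N : Set S}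
    {s : Fin k → ∀ x, V S ρ x} (hs : IsHoloFrame U N s) {x : S} (hx : x ∈ N) (a : Fin k → ℂ) :
    ∑ i, a i • s i x ∈ U x := by
  rw [← hs.span x hx]
  exact Submodule.sum_mem _ fun i _ => Submodule.smul_mem _ _ (Submodule.subset_span ⟨i, rfl⟩)

theorem LocIso.lift_sum {k : ℕ} {f g : S → S} {x y : S} (h : LocIso f g x y)
    (s : Fin k → ∀ x, V S ρ x) (a : Fin k → ℂ) :
    lift f (TotalSpace.mk' C4 x (∑ i, a i • s i x)) =
      TotalSpace.mk' C4 y (∑ i, a i • pushSec f g (s i) y) := by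
  rw [lift_eq_mk h.map_eq, map_sum]
  simp only [map_smul, h.pushSec_apply]

namespace SymOn

variable {f g : S → S} {W W' : Set S}

/-- Pushing a frame forward supplies, inside a prescribed open set, the frame in which holomorphy of
a function on the target can be tested. -/
theorem exists_isHoloFrame (hf : SymOn ν f W) (hW : IsOpen W) {k : S → S} {x y : S} (hx : x ∈ W)
    (h : LocIso f k x y) {N : Set S} {s : Fin 2 → ∀ x, V S ρ x} (hN : IsOpen N) (hxN : x ∈ N)
    (hs : IsHoloFrame (ν.U e) N s) {M : Set S} (hM : IsOpen M) (hy : y ∈ M) :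
    ∃ N' ⊆ M, IsOpen N' ∧ y ∈ N' ∧ (∀ y' ∈ N', k y' ∈ N ∧ LocIso f k (k y') y') ∧
      IsHoloFrame (ν.U e) N' (fun i => pushSec f k (s i)) := by
  have hev : ∀ᶠ y' in 𝓝 y, (k y' ∈ W ∧ k y' ∈ N ∧ LocIso f k (k y') y') ∧ y' ∈ M := by
    filter_upwards [h.symm.tendsto.eventually (hW.mem_nhds hx),
      h.symm.tendsto.eventually (hN.mem_nhds hxN), h.symm.eventually, hM.mem_nhds hy]
      with y' h1 h2 h3 h4
    exact ⟨⟨h1, h2, h3.symm⟩, h4⟩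
  obtain ⟨N', hN', hN'o, hyN'⟩ := eventually_nhds_iff.1 hev
  refine ⟨N', fun y' h' => (hN' y' h').2, hN'o, hyN', fun y' h' => (hN' y' h').1.2, ?_, ?_, ?_⟩
  · intro i y' h'
    obtain ⟨⟨-, h2, h3⟩, -⟩ := hN' y' h'
    exact (h3.contMDiffAt_pushSec ((hs.holo i).contMDiffAt (hN.mem_nhds h2))).contMDiffWithinAt
  · intro y' h'
    obtain ⟨⟨-, h2, h3⟩, -⟩ := hN' y' h'
    exact (hs.indep _ h2).map' _ (LinearMap.ker_eq_bot.2 h3.pushTo_bijective.1)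
  · intro y' h'
    obtain ⟨⟨h1, h2, h3⟩, -⟩ := hN' y' h'
    obtain ⟨g', hg'⟩ := hf _ h1
    rw [h3.map_eq] at hg'
    rw [← hg'.null e, ← hs.span _ h2, Submodule.map_span, ← range_comp]
    rfl

/-- The map of the nonzero vectors of `U^±` induced by a symmetry. -/
def liftVec (hf : SymOn ν f W) (hm : MapsTo f W W') (P : NonzeroVec (ν.U e) W) :
    NonzeroVec (ν.U e) W' :=
  ⟨lift f P.1, hm P.2.1, by
    obtain ⟨g, hg⟩ := hf _ P.2.1
    change push f P.1.proj P.1.2 ∈ ν.U e (f P.1.proj)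
    rw [← hg.null e]
    exact Submodule.mem_map_of_mem P.2.2.1, by
    obtain ⟨g, hg⟩ := hf _ P.2.1
    exact (map_ne_zero_iff (pushTo ρ f P.1.proj _) hg.pushTo_bijective.1).2 P.2.2.2⟩

theorem continuous_liftVec (hf : SymOn ν f W) (hm : MapsTo f W W') :
    Continuous (hf.liftVec hm : NonzeroVec (ν.U e) W → NonzeroVec (ν.U e) W') := by
  refine Continuous.subtype_mk (continuous_iff_continuousAt.2 fun P => ?_) _
  obtain ⟨g, hg⟩ := hf _ P.2.1
  exact ContinuousAt.comp (g := lift f) hg.contMDiffAt_lift.continuousAt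
    continuous_subtype_val.continuousAt

/-- The map of the bundles `F^±` induced by a symmetry. -/
def mapF (hf : SymOn ν f W) (hm : MapsTo f W W') (p : F ν e W) : F ν e W' :=
  ⟨⟨f p.1, hm p.1.2⟩, Projectivization.map
    ((push f p.1.1).restrict (p := ν.U e p.1) (q := ν.U e (f p.1)) (fun a ha => by
      obtain ⟨g, hg⟩ := hf _ p.1.2
      rw [← hg.null e]
      exact Submodule.mem_map_of_mem ha))
    (fun a b hab => by
      obtain ⟨g, hg⟩ := hf _ p.1.2
      exact Subtype.ext (hg.pushTo_bijective.1 (congrArg Subtype.val hab))) p.2⟩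

theorem mapF_toProj (hf : SymOn ν f W) (hm : MapsTo f W W') (P : NonzeroVec (ν.U e) W) :
    hf.mapF hm (toProj P) = toProj (hf.liftVec hm P) := rfl

theorem isHoloMapF_mapF (hf : SymOn ν f W) (hW : IsOpen W) (hW' : IsOpen W') (hm : MapsTo f W W') :
    IsHoloMapF (hf.mapF hm : F ν e W → F ν e W') where
  continuous := continuous_coinduced_dom.2
    (continuous_toProj.comp (hf.continuous_liftVec hm))
  pullback O k hO hk := by
    intro N s hN hNW hs G hG
    rintro ⟨x, a⟩ ⟨hx, P, hP, hPO⟩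
    dsimp only at hx hP
    obtain ⟨g, hg⟩ := hf x (hNW hx)
    obtain ⟨N', hN'W, hN'o, hyN', hN', hs'⟩ := hf.exists_isHoloFrame hW (hNW hx) hg.toLocIso hN hx
      hs hW' (hm (hNW hx))
    have hlift : ∀ (x' : S) (b : C2) (Q : NonzeroVec (ν.U e) W), f x' ∈ N' → g (f x') = x' →
        Q.1 = TotalSpace.mk' C4 x' (∑ i, b i • s i x') →
        (hf.liftVec hm Q).1 =
          TotalSpace.mk' C4 (f x') (∑ i, b i • pushSec f g (s i) (f x')) := by
      intro x' b Q hx' hgx hQ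
      have h1 := (hN' _ hx').2
      rw [hgx] at h1
      change lift f Q.1 = _
      rw [hQ, h1.lift_sum]
    -- In the pushed frame the coefficients `b` are unchanged, so the local expression on the target
    -- is `G` with only its base variable composed with `g`.
    have key := hk N' _ hN'o hN'W hs' (fun q => G (g q.1, q.2)) (by
      intro P' y b hy hP'
      obtain ⟨h1, h2⟩ := hN' y hy
      have h3 := h2.lift_sum s b
      rw [← hP'] at h3
      have h0 : ∑ i, b i • s i (g y) ≠ 0 := by
        intro h0
        rw [h0, lift_eq_mk h2.map_eq, map_zero] at h3
        apply P'.2.2.2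
        rw [← h3]
      let Q : NonzeroVec (ν.U e) W :=
        ⟨TotalSpace.mk' C4 (g y) (∑ i, b i • s i (g y)), hNW h1, hs.sum_mem h1 b, h0⟩
      have h4 : hf.liftVec hm Q = P' := Subtype.ext h3
      exact (hG Q (g y) b h1 rfl).trans (congrArg (fun R => k (toProj R)) h4))
      (f x, a) ⟨hyN', hf.liftVec hm P, hlift x a P hyN' hg.inv_eq hP, hPO⟩
    have hfa : ContMDiffAt (𝓘(ℂ, C2).prod 𝓘(ℂ, C2)) (𝓘(ℂ, C2).prod 𝓘(ℂ, C2)) ω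
        (fun q : S × C2 => (f q.1, q.2)) (x, a) :=
      (ContMDiffAt.comp (x, a) (g := f) hg.holo contMDiffAt_fst).prodMk contMDiffAt_snd
    have hev : ∀ᶠ q : S × C2 in 𝓝 (x, a), f q.1 ∈ N' ∧ g (f q.1) = q.1 :=
      (continuous_fst.tendsto (x, a)).eventually
        ((hg.tendsto.eventually (hN'o.mem_nhds hyN')).and hg.left_inv)
    -- The description of the lift in the pushed frame holds only near `x`; the domain is cut down
    -- to such points, and `contMDiffWithinAt_inter` removes the cut.
    have key2 := key.comp (x, a) hfa.contMDiffWithinAt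
      (s := {y | y.1 ∈ N ∧ ∃ P : NonzeroVec (ν.U e) W,
        P.1 = TotalSpace.mk' C4 y.1 (∑ i, y.2 i • s i y.1) ∧ toProj P ∈ hf.mapF hm ⁻¹' O} ∩
          {q | f q.1 ∈ N' ∧ g (f q.1) = q.1}) (by
        rintro q ⟨⟨-, Q, hQ, hQO⟩, hq, hq'⟩
        exact ⟨hq, hf.liftVec hm Q, hlift q.1 q.2 Q hq hq' hQ, hQO⟩)
    refine ((contMDiffWithinAt_inter hev).1 key2).congr_of_eventuallyEq ?_ ?_
    · filter_upwards [mem_nhdsWithin_of_mem_nhds hev] with q hq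
      simp [hq.2]
    · simp [hg.inv_eq]

theorem onLift (hf : SymOn ν f W) (hW : IsOpen W) (hm : MapsTo f W W') {p q : F ν e W}
    (h : OnLift ν e W p q) : OnLift ν e W' (hf.mapF hm p) (hf.mapF hm q) := by
  obtain ⟨Ω, c, u, hc, hu, hcu, z, hz, w, hw, P, Q, hP, hQ, rfl, rfl⟩ := h
  have hcW : ∀ z ∈ Ω, c z ∈ W := fun z hz => (hcu z hz).1
  refine ⟨Ω, _, _, hf.isNullCurve hW hc hcW, hf.isHorizontalLift hc hu hcW, fun z hz =>
    ⟨hm (hcW z hz), ?_⟩, z, hz, w, hw, hf.liftVec hm P, hf.liftVec hm Q, ?_, ?_, rfl, rfl⟩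
  · obtain ⟨g, hg⟩ := hf _ (hcW z hz)
    exact (map_ne_zero_iff (pushTo ρ f (c z) _) hg.pushTo_bijective.1).2 (hcu z hz).2
  · exact congrArg (lift f) hP
  · exact congrArg (lift f) hQ

/-- The map of the leaf spaces `T^±` induced by a symmetry. -/
def mapT (hf : SymOn ν f W) (hW : IsOpen W) (hm : MapsTo f W W') : T ν e W → T ν e W' :=
  Quot.map (hf.mapF hm) fun _ _ => hf.onLift hW hm

theorem isHoloMapT_mapT (hf : SymOn ν f W) (hW : IsOpen W) (hW' : IsOpen W')
    (hm : MapsTo f W W') : IsHoloMapT (hf.mapT hW hm : T ν e W → T ν e W') where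
  continuous := continuous_coinduced_dom.2
    (continuous_toLeaf.comp (hf.isHoloMapF_mapF hW hW' hm).continuous)
  pullback _ _ hO hk :=
    (hf.isHoloMapF_mapF hW hW' hm).pullback _ _ (hO.preimage continuous_toLeaf) hk

/-- Being a left inverse on the open set `W` makes `g` agree near `f x` with the inverse germ of
`f`, hence so do the derivatives that define the lifts. -/
theorem leftInverse_mapF (hf : SymOn ν f W) (hm : MapsTo f W W') (hg : SymOn ν g W')
    (hm' : MapsTo g W' W) (hW : IsOpen W) (hgf : ∀ x ∈ W, g (f x) = x) :
    Function.LeftInverse (hg.mapF hm' : F ν e W' → F ν e W) (hf.mapF hm) := by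
  intro p
  obtain ⟨P, rfl⟩ := toProj_surjective p
  rw [mapF_toProj, mapF_toProj]
  congr 1
  refine Subtype.ext ?_
  change lift g (lift f P.1) = P.1
  obtain ⟨k, hk⟩ := hf _ P.2.1
  have h1 := hk.lift_lift P.1.2
  have h2 : g =ᶠ[𝓝 (f P.1.proj)] k := by
    filter_upwards [hk.right_inv, hk.symm.tendsto.eventually (hW.mem_nhds P.2.1)] with y h3 h4
    have := hgf _ h4
    rwa [h3] at this
  exact (lift_congr h2 (push f P.1.proj P.1.2)).trans h1

theorem leftInverse_mapT (hf : SymOn ν f W) (hm : MapsTo f W W') (hg : SymOn ν g W')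
    (hm' : MapsTo g W' W) (hW : IsOpen W) (hW' : IsOpen W') (hgf : ∀ x ∈ W, g (f x) = x) :
    Function.LeftInverse (hg.mapT hW' hm' : T ν e W' → T ν e W) (hf.mapT hW hm) := by
  rintro ⟨p⟩
  exact congrArg toLeaf (hf.leftInverse_mapF hm hg hm' hW hgf p)

/-- The inverse of an injective symmetry is a symmetry. -/
theorem exists_inverse (hf : SymOn ν f W) (hW : IsOpen W) (hinj : InjOn f W) :
    ∃ g, SymOn ν g (f '' W) ∧ MapsTo g (f '' W) W ∧ (∀ x ∈ W, g (f x) = x) ∧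
      ∀ y ∈ f '' W, f (g y) = y := by
  have key : ∀ y, ∃ x, y ∈ f '' W → x ∈ W ∧ f x = y := by
    intro y
    by_cases hy : y ∈ f '' W
    · obtain ⟨x, hx⟩ := hy
      exact ⟨x, fun _ => hx⟩
    -- Off the image the value is arbitrary.
    · exact ⟨y, fun h => absurd h hy⟩
  choose g hg using key
  have hgf : ∀ x ∈ W, g (f x) = x := fun x hx =>
    hinj (hg _ ⟨x, hx, rfl⟩).1 hx (hg _ ⟨x, hx, rfl⟩).2
  refine ⟨g, ?_, fun y hy => (hg y hy).1, hgf, fun y hy => (hg y hy).2⟩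
  rintro _ ⟨x, hx, rfl⟩
  obtain ⟨k, hk⟩ := hf x hx
  refine ⟨f, ?_⟩
  rw [hgf x hx]
  refine hk.symm.congr ?_ EventuallyEq.rfl
  filter_upwards [hk.right_inv, hk.symm.tendsto.eventually (hW.mem_nhds hx)] with y h1 h2
  have := hgf _ h2
  rwa [h1] at this

end SymOn

end

section

/-! ### Linear algebra of the null subbundles -/

variable {𝒞 : CartanConnection S ρ} {ν : NullSubbundles 𝒞}

instance (x : S) : FiniteDimensional ℂ (V S ρ x) := inferInstanceAs (FiniteDimensional ℂ C4)

theorem IsHoloSubbundle.finrank_eq {k : ℕ} {U : ∀ x, Submodule ℂ (V S ρ x)}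
    (hU : IsHoloSubbundle k U) (x : S) : Module.finrank ℂ (U x) = k := by
  obtain ⟨N, -, hx, s, hs⟩ := hU x
  rw [← hs.span x hx, finrank_span_eq_card (hs.indep x hx), Fintype.card_fin]

/-- The sum of an element outside `B` and an element outside `C` would lie in neither: a group is
not the union of two proper subgroups. -/
theorem _root_.Submodule.le_or_le_of_forall_mem {R M : Type*} [Ring R] [AddCommGroup M] [Module R M]
    {A B C : Submodule R M} (h : ∀ a ∈ A, a ∈ B ∨ a ∈ C) : A ≤ B ∨ A ≤ C := by
  by_contra! hne
  obtain ⟨⟨a, ha, haB⟩, ⟨b, hb, hbC⟩⟩ :=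
    And.imp SetLike.not_le_iff_exists.1 SetLike.not_le_iff_exists.1 hne
  have haC := (h a ha).resolve_left haB
  have hbB := (h b hb).resolve_right hbC
  rcases h (a + b) (add_mem ha hb) with h | h
  · exact haB ((Submodule.add_mem_iff_left _ hbB).1 h)
  · exact hbC ((Submodule.add_mem_iff_right _ haC).1 h)

namespace NullSubbundles

theorem inner_self (e : Sgn) (x : S) {a : V S ρ x} (ha : a ∈ ν.U e x) : 𝒞.inner x a a = 0 := by
  refine (ν.null x a (ν.le_perp e x ha)).2 ?_
  cases e
  exacts [Or.inl ha, Or.inr ha]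

/-- Polarization of the null condition. -/
theorem inner_eq_zero (e : Sgn) (x : S) {a b : V S ρ x} (ha : a ∈ ν.U e x) (hb : b ∈ ν.U e x) :
    𝒞.inner x a b = 0 := by
  have h := ν.inner_self e x (add_mem ha hb)
  simp only [map_add, LinearMap.add_apply, ν.inner_self e x ha, ν.inner_self e x hb,
    𝒞.inner_symm x b a] at h
  simpa [← two_mul] using h

theorem inf_eq' {e e' : Sgn} (h : e ≠ e') (x : S) : ν.U e x ⊓ ν.U e' x = 𝒞.Λ x := by
  cases e <;> cases e'
  · exact absurd rfl h
  · exact ν.inf_eq x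
  · rw [inf_comm]
    exact ν.inf_eq x
  · exact absurd rfl h

theorem null' {e e' : Sgn} (h : e ≠ e') (x : S) {a : V S ρ x} (ha : a ∈ 𝒞.perp x)
    (h0 : 𝒞.inner x a a = 0) : a ∈ ν.U e x ∨ a ∈ ν.U e' x := by
  have := (ν.null x a ha).1 h0
  cases e <;> cases e'
  · exact absurd rfl h
  · exact this
  · exact this.symm
  · exact absurd rfl h

theorem exists_notMem_line (ν : NullSubbundles 𝒞) (e : Sgn) (x : S) : ∃ a ∈ ν.U e x, a ∉ 𝒞.Λ x := by
  by_contra! h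
  have h1 := Submodule.finrank_mono (R := ℂ) (show ν.U e x ≤ 𝒞.Λ x from h)
  rw [(ν.subbundle e).finrank_eq, 𝒞.Λ_subbundle.finrank_eq] at h1
  omega

theorem inner_ne_zero {e e' : Sgn} (h : e ≠ e') (x : S) {a b : V S ρ x} (ha : a ∈ ν.U e x)
    (ha' : a ∉ 𝒞.Λ x) (hb : b ∈ ν.U e' x) (hb' : b ∉ 𝒞.Λ x) : 𝒞.inner x a b ≠ 0 := by
  intro h0
  have h1 : 𝒞.inner x (a + b) (a + b) = 0 := by
    simp [ν.inner_self e x ha, ν.inner_self e' x hb, 𝒞.inner_symm x b a, h0]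
  rw [← ν.inf_eq' h] at ha' hb'
  rcases ν.null' h x (add_mem (ν.le_perp e x ha) (ν.le_perp e' x hb)) h1 with h2 | h2
  · exact hb' ⟨(Submodule.add_mem_iff_right _ ha).1 h2, hb⟩
  · exact ha' ⟨ha, (Submodule.add_mem_iff_left _ hb).1 h2⟩

/-- The image consists of null vectors of `Λ^⊥`, so it is contained in the union of the two null
subspaces, hence in one of them, and the dimensions agree. -/
theorem map_eq_or_map_eq {f g : S → S} {x y : S} (hf : LocIso f g x y)
    (line : (𝒞.Λ x).map (pushTo ρ f x y) = 𝒞.Λ y)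
    (inner : ∀ a b, 𝒞.inner y (pushTo ρ f x y a) (pushTo ρ f x y b) = 𝒞.inner x a b)
    {e e' : Sgn} (h : e ≠ e') (i : Sgn) :
    (ν.U i x).map (pushTo ρ f x y) = ν.U e y ∨ (ν.U i x).map (pushTo ρ f x y) = ν.U e' y := by
  have h1 : ∀ a ∈ (ν.U i x).map (pushTo ρ f x y), a ∈ ν.U e y ∨ a ∈ ν.U e' y := by
    rintro _ ⟨a, ha, rfl⟩
    refine ν.null' h y ?_ ((inner a a).trans (ν.inner_self i x ha))
    refine LinearMap.BilinForm.mem_orthogonal_iff.2 fun b hb => ?_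
    rw [← line] at hb
    obtain ⟨b, hb, rfl⟩ := hb
    rw [inner]
    exact LinearMap.BilinForm.mem_orthogonal_iff.1 (ν.le_perp i x ha) b hb
  have h2 : ∀ j, Module.finrank ℂ ((ν.U i x).map (pushTo ρ f x y)) =
      Module.finrank ℂ (ν.U j y) := fun j => by
    rw [← (Submodule.equivMapOfInjective _ hf.pushTo_bijective.1 (ν.U i x)).finrank_eq, (ν.subbundle i).finrank_eq, (ν.subbundle j).finrank_eq]
  exact (Submodule.le_or_le_of_forall_mem h1).imp
    (fun h => Submodule.eq_of_le_of_finrank_eq h (h2 _))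
    (fun h => Submodule.eq_of_le_of_finrank_eq h (h2 _))

end NullSubbundles

/-! ### Continuity of the lifted flow -/

theorem hasFDerivAt_coordD {x₀ y₀ x : S} {f : S → S} (hx : x ∈ (chartAt C2 x₀).source)
    (hy : f x ∈ (chartAt C2 y₀).source) (hf : MDifferentiableAt 𝓘(ℂ, C2) 𝓘(ℂ, C2) f x) :
    HasFDerivAt (chartAt C2 y₀ ∘ f ∘ (chartAt C2 x₀).symm) (coordD x₀ y₀ f x)
      (chartAt C2 x₀ x) := by
  have h1 := hasFDerivWithinAt_tangentCoordChange (I := 𝓘(ℂ, C2)) (x := x₀) (y := x) (z := x)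
    (by simp [hx])
  have h2 := hf.hasMFDerivAt.2
  have h3 := hasFDerivWithinAt_tangentCoordChange (I := 𝓘(ℂ, C2)) (x := f x) (y := y₀) (z := f x)
    (by simp [hy])
  simp only [modelWithCornersSelf_coe, range_id, hasFDerivWithinAt_univ, extChartAt,
    OpenPartialHomeomorph.extend, modelWithCornersSelf_partialEquiv, PartialEquiv.trans_refl,
    writtenInExtChartAt, OpenPartialHomeomorph.toFun_eq_coe,
    OpenPartialHomeomorph.coe_toPartialEquiv_symm] at h1 h2 h3
  have e1 : (chartAt C2 x₀).symm (chartAt C2 x₀ x) = x := (chartAt C2 x₀).left_inv hx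
  have e2 : (chartAt C2 x).symm (chartAt C2 x x) = x :=
    (chartAt C2 x).left_inv (mem_chart_source _ _)
  have h4 := HasFDerivAt.comp (chartAt C2 x₀ x) (g := (chartAt C2 (f x)) ∘ f ∘ (chartAt C2 x).symm)
    (f := (chartAt C2 x) ∘ (chartAt C2 x₀).symm) (g' := dl f x) (by
      rw [Function.comp_apply, e1]
      exact hasFDerivWithinAt_univ.1 h2) h1
  have h5 := HasFDerivAt.comp (chartAt C2 x₀ x) (g := (chartAt C2 y₀) ∘ (chartAt C2 (f x)).symm)
    (f := ((chartAt C2 (f x)) ∘ f ∘ (chartAt C2 x).symm) ∘ ((chartAt C2 x) ∘ (chartAt C2 x₀).symm))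
    (by
      simp only [Function.comp_apply, e1, e2]
      exact h3) h4
  refine h5.congr_of_eventuallyEq ?_
  have c1 : ContinuousAt (chartAt C2 x₀).symm (chartAt C2 x₀ x) :=
    (chartAt C2 x₀).continuousAt_symm ((chartAt C2 x₀).map_source hx)
  have c2 : Tendsto (chartAt C2 x₀).symm (𝓝 (chartAt C2 x₀ x)) (𝓝 x) := by
    have := c1.tendsto
    rwa [e1] at this
  filter_upwards [c2.eventually ((chartAt C2 x).open_source.mem_nhds (mem_chart_source _ _)),
    c2.eventually (hf.continuousAt ((chartAt C2 (f x)).open_source.mem_nhds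
      (mem_chart_source _ _)))] with u h1 h2
  simp only [Function.comp_apply]
  rw [(chartAt C2 x).left_inv h1, (chartAt C2 (f x)).left_inv h2]

end

section

/-! ### Symmetries generated by a flow -/

variable {𝒞 : CartanConnection S ρ} {ν : NullSubbundles 𝒞}

namespace LocalFlow

variable {X : ∀ x : S, TangentSpace 𝓘(ℂ, C2) x} (fl : LocalFlow X)

theorem isOpen_slice (t : ℝ) : IsOpen {x | (t, x) ∈ fl.dom} :=
  fl.isOpen_dom.preimage (by fun_prop : Continuous fun x : S => (t, x))

theorem contMDiffAt_real {p : ℝ × S} (hp : p ∈ fl.dom) :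
    ContMDiffAt (𝓘(ℝ, ℝ).prod 𝓘(ℝ, C2)) 𝓘(ℝ, C2) ∞ (fun p : ℝ × S => fl.φ p.1 p.2) p :=
  fl.smooth.contMDiffAt (fl.isOpen_dom.mem_nhds hp)

theorem continuousAt {p : ℝ × S} (hp : p ∈ fl.dom) :
    ContinuousAt (fun p : ℝ × S => fl.φ p.1 p.2) p :=
  (fl.contMDiffAt_real hp).continuousAt

theorem contMDiffAt {t : ℝ} {x : S} (h : (t, x) ∈ fl.dom) :
    ContMDiffAt 𝓘(ℂ, C2) 𝓘(ℂ, C2) ω (fl.φ t) x :=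
  (fl.holo t).contMDiffAt ((fl.isOpen_slice t).mem_nhds h)

theorem tendsto_zero (x : S) :
    Tendsto (fun p : ℝ × S => fl.φ p.1 p.2) (𝓝 ((0 : ℝ), x)) (𝓝 x) := by
  have := (fl.continuousAt (fl.zero_mem x)).tendsto
  simpa only [fl.φ_zero] using this

theorem tendsto_neg (x : S) :
    Tendsto (fun p : ℝ × S => (-p.1, fl.φ p.1 p.2)) (𝓝 ((0 : ℝ), x)) (𝓝 ((0 : ℝ), x)) := by
  have h : Tendsto (fun p : ℝ × S => -p.1) (𝓝 ((0 : ℝ), x)) (𝓝 (-(0 : ℝ))) :=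
    (continuous_fst.neg).tendsto _
  rw [neg_zero] at h
  exact h.prodMk_nhds (fl.tendsto_zero x)

theorem eventually_neg (x : S) : ∀ᶠ p in 𝓝 ((0 : ℝ), x), fl.φ (-p.1) (fl.φ p.1 p.2) = p.2 := by
  have hd : ∀ᶠ p in 𝓝 ((0 : ℝ), x), p ∈ fl.dom := fl.isOpen_dom.mem_nhds (fl.zero_mem x)
  filter_upwards [hd, (fl.tendsto_neg x).eventually hd] with p h1 h2
  rw [← fl.φ_add p.1 (-p.1) p.2 h1 h2 (by rw [neg_add_cancel]; exact fl.zero_mem _),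
    neg_add_cancel, fl.φ_zero]

theorem eventually_locIso (x : S) :
    ∀ᶠ p in 𝓝 ((0 : ℝ), x), LocIso (fl.φ p.1) (fl.φ (-p.1)) p.2 (fl.φ p.1 p.2) := by
  have hd : ∀ᶠ p in 𝓝 ((0 : ℝ), x), p ∈ fl.dom := fl.isOpen_dom.mem_nhds (fl.zero_mem x)
  have hn := (fl.eventually_neg x).eventually_nhds
  have hs : ∀ p : ℝ × S, Tendsto (fun y : S => (p.1, y)) (𝓝 p.2) (𝓝 p) := fun p =>
    (by fun_prop : Continuous fun y : S => (p.1, y)).tendsto p.2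
  filter_upwards [hd, (fl.tendsto_neg x).eventually hd, hn, (fl.tendsto_neg x).eventually hn]
    with p h1 h2 h3 h4
  refine ⟨rfl, h3.self_of_nhds, fl.contMDiffAt h1, fl.contMDiffAt h2, (hs p).eventually h3, ?_⟩
  have := (hs (-p.1, fl.φ p.1 p.2)).eventually h4
  simpa only [neg_neg] using this

/-- In charts the flow is jointly smooth over `ℝ`, so its real derivative in the space variable is
continuous in time and point. That derivative is `coordD` with scalars restricted, and restriction
of scalars is an isometric embedding. -/
theorem continuousAt_coordD (x : S) :
    ContinuousAt (fun p : ℝ × S => coordD x x (fl.φ p.1) p.2) ((0 : ℝ), x) := by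
  set χ := chartAt C2 x with hχ
  have hxs : x ∈ χ.source := mem_chart_source C2 x
  let ψ : ℝ × C2 → C2 := fun q => χ (fl.φ q.1 (χ.symm q.2))
  have hψ : ContDiffAt ℝ ∞ ψ (0, χ x) := by
    have h := (contMDiffAt_iff.1 (fl.contMDiffAt_real (fl.zero_mem x))).2
    simp only [fl.φ_zero] at h
    rw [extChartAt_prod] at h
    simp only [mfld_simps, Prod.map_id, range_id, contDiffWithinAt_univ] at h
    exact h
  have hcont : ContinuousAt (fun p : ℝ × S => (fderiv ℝ ψ (p.1, χ p.2)).comp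
      (ContinuousLinearMap.inr ℝ ℝ C2)) ((0 : ℝ), x) := by
    have h1 : ContinuousAt (fun p : ℝ × S => (p.1, χ p.2)) ((0 : ℝ), x) :=
      continuousAt_fst.prodMk
        (ContinuousAt.comp (g := χ) (f := Prod.snd) (χ.continuousAt hxs) continuousAt_snd)
    have h2 : ContinuousAt (fderiv ℝ ψ) ((fun p : ℝ × S => (p.1, χ p.2)) ((0 : ℝ), x)) :=
      hψ.continuousAt_fderiv (by simp)
    exact (ContinuousAt.comp (g := fderiv ℝ ψ) (f := fun p : ℝ × S => (p.1, χ p.2)) h2 h1).clm_comp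
      continuousAt_const
  have hiso := (ContinuousLinearMap.restrictScalarsIsometry ℂ C2 C2 ℝ ℝ).isometry.isEmbedding
  rw [hiso.isInducing.continuousAt_iff]
  refine hcont.congr ?_
  have hψ' : ∀ᶠ p : ℝ × S in 𝓝 ((0 : ℝ), x), DifferentiableAt ℝ ψ (p.1, χ p.2) := by
    have h1 : ∀ᶠ q in 𝓝 ((0 : ℝ), χ x), DifferentiableAt ℝ ψ q :=
      ((hψ.of_le (m := 1) (by simp)).eventually (by simp)).mono fun q hq =>
        hq.differentiableAt (by simp)
    have h2 : ContinuousAt (fun p : ℝ × S => (p.1, χ p.2)) ((0 : ℝ), x) :=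
      continuousAt_fst.prodMk
        (ContinuousAt.comp (g := χ) (f := Prod.snd) (χ.continuousAt hxs) continuousAt_snd)
    exact h2.eventually h1
  have hs : ∀ᶠ y in 𝓝 x, y ∈ χ.source := χ.open_source.mem_nhds hxs
  filter_upwards [hψ', fl.eventually_locIso x, (continuous_snd.tendsto ((0 : ℝ), x)).eventually hs,
    (fl.tendsto_zero x).eventually hs] with p h1 h2 h3 h4
  have h5 := (hasFDerivAt_coordD h3 h4 h2.mdiff).restrictScalars ℝ
  have h6 : HasFDerivAt (fun u : C2 => (p.1, u)) (ContinuousLinearMap.inr ℝ ℝ C2) (χ p.2) :=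
    hasFDerivAt_prodMk_right p.1 (χ p.2)
  exact (h1.hasFDerivAt.comp (χ p.2) h6).unique h5

end LocalFlow

end

section

/-! ### Symmetries for all times -/

variable {𝒞 : CartanConnection S ρ} {ν : NullSubbundles 𝒞}

/-! ### Small times: the flow does not exchange the two null subbundles. -/

theorem eq_sum_localFrame {x₀ y : S} (hy : y ∈ (chartAt C2 x₀).source) (a : V S ρ y) :
    a = ∑ i, (trivializationAt C4 (V S ρ) x₀ (TotalSpace.mk' C4 y a)).2 i •
      (trivializationAt C4 (V S ρ) x₀).localFrame (EuclideanSpace.basisFun (Fin 4) ℂ).toBasis i y := by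
  have hy' : y ∈ (trivializationAt C4 (V S ρ) x₀).baseSet := hy
  have h := (((trivializationAt C4 (V S ρ) x₀).basisAt
    (EuclideanSpace.basisFun (Fin 4) ℂ).toBasis hy').sum_repr a).symm
  refine h.trans (Finset.sum_congr rfl fun i _ => ?_)
  rw [Trivialization.localFrame_apply_of_mem_baseSet _ _ hy']
  congr 1

theorem eventually_mem_chart_source {x : S} {A : Type*} [TopologicalSpace A] {F : A → S} {p : A}
    (hF : Tendsto F (𝓝 p) (𝓝 x)) : ∀ᶠ q in 𝓝 p, F q ∈ (chartAt C2 x).source :=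
  hF.eventually ((chartAt C2 x).open_source.mem_nhds (mem_chart_source C2 x))

namespace LocalFlow

variable {X : ∀ x : S, TangentSpace 𝓘(ℂ, C2) x} (fl : LocalFlow X)

theorem pushTo_zero (x y : S) (a : V S ρ x) : (pushTo ρ (fl.φ 0) x y a : C4) = a := by
  have h : fl.φ 0 = id := funext fl.φ_zero
  change ρ.map (dl (fl.φ 0) x) a = a
  rw [h, dl_id, ρ.map_one]
  rfl

/-- In a local frame the pairing is a finite sum: the coefficients are continuous through
`ρ(coordD)`, and the pairings of the frame with `τ` are holomorphic functions evaluated at the moved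
point. -/
theorem continuousAt_inner_push (𝒞 : CartanConnection S ρ) {x : S} {N : Set S} (hN : IsOpen N)
    (hx : x ∈ N) {σ τ : ∀ x, V S ρ x} (hσ : HoloOn σ N) (hτ : HoloOn τ N) :
    ContinuousAt (fun p : ℝ × S => 𝒞.inner (fl.φ p.1 p.2) (push (fl.φ p.1) p.2 (σ p.2))
      (τ (fl.φ p.1 p.2))) ((0 : ℝ), x) := by
  let e := trivializationAt C4 (V S ρ) x
  let E := e.localFrame (EuclideanSpace.basisFun (Fin 4) ℂ).toBasis
  let co : ℝ × S → C4 := fun p =>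
    ρ.map (coordD x x (fl.φ p.1) p.2) (e (TotalSpace.mk' C4 p.2 (σ p.2))).2
  have hco : ContinuousAt co ((0 : ℝ), x) := by
    have hu : IsUnit (coordD x x (fl.φ 0) x) := by
      have h : fl.φ 0 = id := funext fl.φ_zero
      rw [h]
      exact isUnit_coordD (mem_chart_source _ _) (mem_chart_source _ _)
        (by rw [dl_id]; exact isUnit_one)
    have h1 : ContinuousAt (fun p : ℝ × S => ρ.map (coordD x x (fl.φ p.1) p.2)) ((0 : ℝ), x) :=
      ContinuousAt.comp (g := ρ.map) (f := fun p : ℝ × S => coordD x x (fl.φ p.1) p.2)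
        (x := ((0 : ℝ), x)) (ρ.contMDiffAt_map hu).continuousAt (fl.continuousAt_coordD x)
    have h2 : ContinuousAt (fun y => (e (TotalSpace.mk' C4 y (σ y))).2) x :=
      ((contMDiffAt_section _).1 (hσ.contMDiffAt (hN.mem_nhds hx))).continuousAt
    exact h1.clm_apply (ContinuousAt.comp (f := Prod.snd) (x := ((0 : ℝ), x)) h2 continuousAt_snd)
  have hG : ∀ i, ContinuousAt (fun p : ℝ × S => 𝒞.inner (fl.φ p.1 p.2) (E i (fl.φ p.1 p.2))
      (τ (fl.φ p.1 p.2))) ((0 : ℝ), x) := by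
    intro i
    have hb : x ∈ e.baseSet := FiberBundle.mem_baseSet_trivializationAt' x
    have h1 := 𝒞.inner_holo (N ∩ e.baseSet) (hN.inter e.open_baseSet) (E i) τ
      ((e.contMDiffOn_localFrame_baseSet (I := 𝓘(ℂ, C2)) ω _ i).mono inter_subset_right)
      (hτ.mono inter_subset_left)
    have h2 := (h1.contMDiffAt ((hN.inter e.open_baseSet).mem_nhds ⟨hx, hb⟩)).continuousAt
    refine ContinuousAt.comp_of_eq (f := fun p : ℝ × S => fl.φ p.1 p.2) h2
      (fl.continuousAt (fl.zero_mem x)) (fl.φ_zero x)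
  have hsum : ContinuousAt (fun p : ℝ × S => ∑ i, co p i * 𝒞.inner (fl.φ p.1 p.2)
      (E i (fl.φ p.1 p.2)) (τ (fl.φ p.1 p.2))) ((0 : ℝ), x) :=
    tendsto_finsetSum _ fun i _ =>
      (ContinuousAt.comp (g := fun v : C4 => v i) (by fun_prop) hco).mul (hG i)
  refine hsum.congr ?_
  filter_upwards [eventually_mem_chart_source (fl.tendsto_zero x),
    eventually_mem_chart_source (continuous_snd.tendsto ((0 : ℝ), x)), fl.eventually_locIso x]
    with p h1 h2 h3
  have h4 : co p = (e (TotalSpace.mk' C4 (fl.φ p.1 p.2) (push (fl.φ p.1) p.2 (σ p.2)))).2 :=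
    (trivializationAt_lift h2 h1 h3.isUnit (σ p.2)).symm
  rw [eq_sum_localFrame h1 (push (fl.φ p.1) p.2 (σ p.2)), map_sum, LinearMap.sum_apply]
  simp only [map_smul, LinearMap.smul_apply, smul_eq_mul]
  rw [h4]

theorem eventually_map_ne (ν : NullSubbundles 𝒞) {e e' : Sgn} (h : e ≠ e') (x : S) :
    ∀ᶠ p in 𝓝 ((0 : ℝ), x), (ν.U e p.2).map (push (ρ := ρ) (fl.φ p.1) p.2) ≠ ν.U e' (fl.φ p.1 p.2) := by
  obtain ⟨a, ha, ha'⟩ := ν.exists_notMem_line e x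
  obtain ⟨b, hb, hb'⟩ := ν.exists_notMem_line e' x
  obtain ⟨N, σ, hN, hxN, hσ, hσm, rfl⟩ := exists_section (ν.subbundle e) x a ha
  obtain ⟨N', τ, hN', hxN', hτ, hτm, rfl⟩ := exists_section (ν.subbundle e') x b hb
  have hc := fl.continuousAt_inner_push 𝒞 (hN.inter hN') ⟨hxN, hxN'⟩ (hσ.mono inter_subset_left)
    (hτ.mono inter_subset_right)
  have h0 : 𝒞.inner (fl.φ 0 x) (push (fl.φ 0) x (σ x)) (τ (fl.φ 0 x)) ≠ 0 := by
    -- The identity `φ_0 x = x` is not definitional, so the base point is generalized before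
    -- substitution.
    have key : ∀ y, y = x → 𝒞.inner y (pushTo ρ (fl.φ 0) x y (σ x)) (τ y) ≠ 0 := by
      rintro y rfl
      rw [show pushTo ρ (fl.φ 0) y y (σ y) = σ y from fl.pushTo_zero y y (σ y)]
      exact ν.inner_ne_zero h y ha ha' hb hb'
    exact key _ (fl.φ_zero x)
  filter_upwards [hc.eventually_ne h0, (continuous_snd.tendsto ((0 : ℝ), x)).eventually
    (hN.mem_nhds hxN), (fl.tendsto_zero x).eventually (hN'.mem_nhds hxN')] with p h1 h2 h3 h4
  refine h1 (ν.inner_eq_zero e' _ ?_ (hτm _ h3))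
  rw [← h4]
  exact Submodule.mem_map_of_mem (hσm _ h2)

theorem eventually_sym (ν : NullSubbundles 𝒞) (hsym : IsSymmetry 𝒞 fl) (x : S) :
    ∀ᶠ p in 𝓝 ((0 : ℝ), x), Sym ν (fl.φ p.1) (fl.φ (-p.1)) p.2 (fl.φ p.1 p.2) := by
  have hne : Sgn.plus ≠ Sgn.minus := by simp
  filter_upwards [fl.eventually_locIso x, hsym x, fl.eventually_map_ne ν hne x,
    fl.eventually_map_ne ν hne.symm x] with p h1 h2 h3 h4
  refine ⟨h1, h2.line, h2.inner, h2.conn, fun e => ?_⟩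
  have key := ν.map_eq_or_map_eq h1 h2.line h2.inner hne e
  cases e
  · exact key.resolve_right h3
  · exact key.resolve_left h4

/-! ### Propagation from small times to all times. -/

theorem tendsto_sub (s : ℝ) (x : S) :
    Tendsto (fun r => (r - s, fl.φ s x)) (𝓝 s) (𝓝 ((0 : ℝ), fl.φ s x)) := by
  have : Continuous fun r : ℝ => (r - s, fl.φ s x) := by fun_prop
  simpa using this.tendsto s

theorem continuousAt_slice {s : ℝ} {x : S} (h : (s, x) ∈ fl.dom) : ContinuousAt (fl.φ s) x :=
  (fl.contMDiffAt h).continuousAt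

theorem eventually_slice {s : ℝ} {x : S} (h : (s, x) ∈ fl.dom) : ∀ᶠ r in 𝓝 s, (r, x) ∈ fl.dom :=
  (by fun_prop : Continuous fun r : ℝ => (r, x)).tendsto s (fl.isOpen_dom.mem_nhds h)

theorem eventuallyEq_comp {s r : ℝ} {x : S} (hs : (s, x) ∈ fl.dom) (hr : (r, x) ∈ fl.dom)
    (hrs : (r - s, fl.φ s x) ∈ fl.dom) : fl.φ r =ᶠ[𝓝 x] fl.φ (r - s) ∘ fl.φ s := by
  filter_upwards [(fl.isOpen_slice s).mem_nhds hs, (fl.isOpen_slice r).mem_nhds hr,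
    fl.continuousAt_slice hs ((fl.isOpen_slice (r - s)).mem_nhds hrs)] with y h1 h2 h3
  have := fl.φ_add s (r - s) y h1 h3 (by rw [sub_add_cancel]; exact h2)
  rwa [sub_add_cancel] at this

theorem exists_sym (ν : NullSubbundles 𝒞) (hsym : IsSymmetry 𝒞 fl) {t : ℝ} {x : S}
    (ht : (t, x) ∈ fl.dom) : ∃ g, Sym ν (fl.φ t) g x (fl.φ t x) := by
  have hpre : IsPreconnected {s : ℝ | (s, x) ∈ fl.dom} := (fl.ordConnected x).isPreconnected
  have h0 : ∃ g, Sym ν (fl.φ 0) g x (fl.φ 0 x) :=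
    ⟨_, (fl.eventually_sym ν hsym x).self_of_nhds⟩
  -- On a preconnected set of times, an equivalence relation whose classes are locally constant
  -- relates any two times.
  refine (hpre.induction₂ (fun s r => (∃ g, Sym ν (fl.φ s) g x (fl.φ s x)) ↔
    ∃ g, Sym ν (fl.φ r) g x (fl.φ r x)) ?_ (fun _ _ _ _ _ _ h h' => h.trans h')
    (fun _ _ _ _ h => h.symm) (fl.zero_mem x) ht).1 h0
  intro s hs
  refine eventually_nhdsWithin_of_eventually_nhds ?_
  filter_upwards [fl.eventually_slice hs,
    (fl.tendsto_sub s x).eventually (fl.isOpen_dom.mem_nhds (fl.zero_mem _)),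
    (fl.tendsto_sub s x).eventually (fl.eventually_sym ν hsym (fl.φ s x))] with r h1 h2 h3
  have heq := fl.eventuallyEq_comp hs h1 h2
  have h4 : fl.φ (r - s) (fl.φ s x) = fl.φ r x := heq.self_of_nhds.symm
  rw [h4] at h3
  constructor
  · rintro ⟨g, hg⟩
    exact ⟨_, (hg.comp h3).congr heq EventuallyEq.rfl⟩
  · rintro ⟨g, hg⟩
    -- Going back from time `r` to time `s` uses the inverse germ of `φ_(r-s)`.
    refine ⟨_, (hg.comp h3.symm).congr ?_ EventuallyEq.rfl⟩
    filter_upwards [heq, fl.continuousAt_slice hs h3.left_inv] with y h5 h6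
    rw [Function.comp_apply, h5]
    exact h6.symm

/-- `φ_(-t)` is not known to be defined at `φ_t x`, so `φ_t` cannot be inverted directly. Instead,
coincidence of two trajectories is locally constant in time on the interval where both are defined,
and is traced back to time zero. -/
theorem injOn (t : ℝ) : InjOn (fl.φ t) {x | (t, x) ∈ fl.dom} := by
  intro x hx y hy hxy
  have hpre : IsPreconnected ({s : ℝ | (s, x) ∈ fl.dom} ∩ {s : ℝ | (s, y) ∈ fl.dom}) :=
    ((fl.ordConnected x).inter (fl.ordConnected y)).isPreconnected
  have h := (hpre.induction₂ (fun s r => fl.φ s x = fl.φ s y ↔ fl.φ r x = fl.φ r y) ?_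
    (fun _ _ _ _ _ _ h h' => h.trans h') (fun _ _ _ _ h => h.symm) ⟨hx, hy⟩
    ⟨fl.zero_mem x, fl.zero_mem y⟩).1 hxy
  · rwa [fl.φ_zero, fl.φ_zero] at h
  intro s hs
  refine eventually_nhdsWithin_of_eventually_nhds ?_
  have key : ∀ z, (s, z) ∈ fl.dom → ∀ᶠ r in 𝓝 s, fl.φ r z = fl.φ (r - s) (fl.φ s z) ∧
      fl.φ (-(r - s)) (fl.φ (r - s) (fl.φ s z)) = fl.φ s z := by
    intro z hz
    filter_upwards [fl.eventually_slice hz,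
      (fl.tendsto_sub s z).eventually (fl.isOpen_dom.mem_nhds (fl.zero_mem _)),
      (fl.tendsto_sub s z).eventually (fl.eventually_neg (fl.φ s z))] with r h1 h2 h3
    exact ⟨(fl.eventuallyEq_comp hz h1 h2).self_of_nhds, h3⟩
  filter_upwards [key x hs.1, key y hs.2] with r h1 h2
  constructor
  · intro h
    rw [h1.1, h2.1, h]
  · intro h
    rw [← h1.2, ← h2.2, ← h1.1, ← h2.1, h]

end LocalFlow

end

end Flow

end CartanSymmetry

end

theorem mainTheorem5 {S : Type*} [TopologicalSpace S] [T2Space S] [ChartedSpace C2 S]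
    [IsManifold 𝓘(ℂ, C2) ω S] {ρ : HolRep} (𝒞 : CartanConnection S ρ) (ν : NullSubbundles 𝒞)
    (X : ∀ x : S, TangentSpace 𝓘(ℂ, C2) x)
    (hX : ContMDiff 𝓘(ℂ, C2) (𝓘(ℂ, C2).prod 𝓘(ℂ, C2)) ω
      (fun x => (⟨x, X x⟩ : TangentBundle 𝓘(ℂ, C2) S)))
    (fl : LocalFlow X) (hsym : IsSymmetry 𝒞 fl) (e : Sgn) (t : ℝ) :
    -- the lifted flow is a linear isomorphism on fibres and preserves `U^±`
    (∀ x, (t, x) ∈ fl.dom →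
      Function.Bijective (push (ρ := ρ) (fl.φ t) x) ∧
      (ν.U e x).map (push (fl.φ t) x) = ν.U e (fl.φ t x)) ∧
    -- it commutes with scalar multiplication
    (∀ (x : S) (r : ℂ) (a : V S ρ x),
      lift (fl.φ t) (Bundle.TotalSpace.mk' C4 x (r • a)) =
        Bundle.TotalSpace.mk' C4 (fl.φ t x) (r • push (fl.φ t) x a)) ∧
    -- it maps horizontal lifts of the curves `C^±` to horizontal lifts of the curves `C^±`
    (∀ (Ω : Set ℂ) (c : ℂ → S) (u : ∀ z, V S ρ (c z)),
      IsNullCurve ν e Ω c → IsHorizontalLift ν e Ω c u → (∀ z ∈ Ω, (t, c z) ∈ fl.dom) →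
      IsNullCurve ν e Ω (fun z => fl.φ t (c z)) ∧
      IsHorizontalLift ν e Ω (fun z => fl.φ t (c z)) (fun z => push (fl.φ t) (c z) (u z))) ∧
    -- it induces a transformation of `F^±`, which descends to a transformation of `T^±`
    (∀ W W' : Set S, IsOpen W → IsOpen W' → (∀ x ∈ W, (t, x) ∈ fl.dom) →
      Set.MapsTo (fl.φ t) W W' →
      ∃ (Φ : F ν e W → F ν e W') (f : T ν e W → T ν e W'),
        (∀ P : NonzeroVec (ν.U e) W, ∃ Q : NonzeroVec (ν.U e) W',
          Q.1 = lift (fl.φ t) P.1 ∧ Φ (toProj P) = toProj Q) ∧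
        (∀ p, f (toLeaf p) = toLeaf (Φ p)) ∧
        IsHoloMapF Φ ∧ IsHoloMapT f ∧
        (fl.φ t '' W = W' →
          (∃ Ψ : F ν e W' → F ν e W, Function.LeftInverse Ψ Φ ∧ Function.RightInverse Ψ Φ ∧
            IsHoloMapF Ψ) ∧
          (∃ h : T ν e W' → T ν e W, Function.LeftInverse h f ∧ Function.RightInverse h f ∧
            IsHoloMapT h))) := by
  have hsymm : ∀ W : Set S, (∀ x ∈ W, (t, x) ∈ fl.dom) → SymOn ν (fl.φ t) W :=
    fun W hW x hx => fl.exists_sym ν hsym (hW x hx)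
  refine ⟨fun x hx => ?_, fun x r a => ?_, fun Ω c u hc hu hcd => ?_, fun W W' hW hW' hd hm => ?_⟩
  · obtain ⟨g, hg⟩ := fl.exists_sym ν hsym hx
    exact ⟨hg.pushTo_bijective, hg.null e⟩
  · rw [← map_smul]
    rfl
  · have hs := hsymm {x | (t, x) ∈ fl.dom} fun _ hx => hx
    exact ⟨hs.isNullCurve (fl.isOpen_slice t) hc hcd, hs.isHorizontalLift hc hu hcd⟩
  · have hs := hsymm W hd
    refine ⟨hs.mapF hm, hs.mapT hW hm, fun P => ⟨hs.liftVec hm P, rfl, rfl⟩, fun p => rfl,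
      hs.isHoloMapF_mapF hW hW' hm, hs.isHoloMapT_mapT hW hW' hm, ?_⟩
    rintro rfl
    obtain ⟨g, hg, hgm, hgf, hfg⟩ := hs.exists_inverse hW ((fl.injOn t).mono hd)
    exact ⟨⟨hg.mapF hgm, hs.leftInverse_mapF hm hg hgm hW hgf,
        hg.leftInverse_mapF hgm hs hm hW' hfg, hg.isHoloMapF_mapF hW' hW hgm⟩,
      ⟨hg.mapT hW' hgm, hs.leftInverse_mapT hm hg hgm hW hW' hgf,
        hg.leftInverse_mapT hgm hs hm hW' hW hfg, hg.isHoloMapT_mapT hW' hW hgm⟩⟩
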